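/- Let $N\ge 1$, let $\Omega\subset\mathbb R^N$ be a non-empty open convex set with boundary of class $C^1$ and finite Lebesgue measure, let $T>0$, $Q_T=\Omega\times(0,T)$, $p>1$, and let $\alpha:(0,\infty)\to(0,\infty)$ be a $C^2$ function such that $$-1<\inf_{s>0}\frac{2s\alpha'(s)}{\alpha(s)}\le\sup_{s>0}\frac{2s\alpha'(s)}{\alpha(s)}<\infty,\qquad \underline\alpha\, s^{\frac{p-2}2}\le\alpha(s)\le\overline\alpha\, s^{\frac{p-2}2}\quad(s>0)$$ for some constants $0<\underline\alpha\le\overline\alpha<\infty$. For $\varepsilon>0$ put $\alpha_\varepsilon(s)=\alpha(s+\varepsilon)$, let $f_\varepsilon\in C^1(Q_T)$, and consider the problem $$\partial_t u_\varepsilon-\alpha_\varepsilon(|Du_\varepsilon|^2)\Big(\Delta u_\varepsilon+\frac{2\alpha_\varepsilon'(|Du_\varepsilon|^2)}{\alpha_\varepsilon(|Du_\varepsilon|^2)}\,D^2u_\varepsilon Du_\varepsilon\cdot Du_\varepsilon\Big)=f_\varepsilon\ \text{ in }Q_T,\qquad \partial_\nu u_\varepsilon=0\ \text{ on }\partial\Omega\times(0,T),\qquad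 u_\varepsilon(\cdot,0)=u_0\ \text{ in }\Omega .$$ By a solution we mean a smooth one: $u_\varepsilon$, $Du_\varepsilon$, $D^2u_\varepsilon$ are continuous on $\overline\Omega\times(0,T)$; $D^3u_\varepsilon$, $\partial_tu_\varepsilon$, $D\partial_tu_\varepsilon$ are continuous in $Q_T$; the equation and the Neumann condition hold pointwise, and $u_\varepsilon(t)\to u_0$ in $W^{1,2}(\Omega)$ as $t\to0^+$. There are constants $C(m,T)$, for $m\in(2,\infty]$ and $T>0$, depending only on $m$ and $T$ (not on $\varepsilon$, $p$, $\alpha$, $N$, $\Omega$ or the data), such that for every $m\in(2,\infty]$, every $f_\varepsilon$ as above with $f_\varepsilon\in L^m(Q_T)$ and every $u_0\in W^{1,m}(\Omega)$, each solution satisfies $$\sup_{0<t<T}\|Du_\varepsilon(t)\|_{L^m(\Omega)}\le C(m,T)\big(\|Df_\varepsilon\|_{L^m(Q_T)}+\|Du_0\|_{L^m(\Omega)}\big)$$ (the right-hand side being $+\infty$ if $Df_\varepsilon\notin L^m(Q_T)$), and $C(m,T)\to C(\infty,T)\in(0,\infty)$ as $m\to\infty$. In particular, Lipschitz regularity is preserved.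 -/

import Mathlib

open MeasureTheory Set Filter Topology
open scoped ENNReal NNReal ContDiff

namespace QuasilinearNeumann

/-- Euclidean space of dimension `N`. -/
abbrev Euc (N : ℕ) : Type := EuclideanSpace ℝ (Fin N)

/-! ### The diffusion coefficient -/

/-- The standing assumptions on `α : (0, ∞) → (0, ∞)`: it is of class `C²`, its index
`2 s α'(s) / α(s)` has infimum `iα > -1` and finite supremum `sα`, and `α(s)` is comparable
with `s ^ ((p - 2) / 2)`. -/
structure IsDiffusion (p : ℝ) (α : ℝ → ℝ) : Prop where
  pos : ∀ s, 0 < s → 0 < α s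
  smooth : ContDiffOn ℝ 2 α (Ioi 0)
  lower_index : ∃ iα : ℝ, -1 < iα ∧ IsGLB ((fun s => 2 * s * deriv α s / α s) '' Ioi 0) iα
  upper_index : ∃ sα : ℝ, IsLUB ((fun s => 2 * s * deriv α s / α s) '' Ioi 0) sα
  growth : ∃ a b : ℝ, 0 < a ∧ a ≤ b ∧
    ∀ s, 0 < s → a * s ^ ((p - 2) / 2) ≤ α s ∧ α s ≤ b * s ^ ((p - 2) / 2)

/-- The regularized coefficient `α_ε(s) = α(s + ε)`. -/
def regCoeff (α : ℝ → ℝ) (ε s : ℝ) : ℝ := α (s + ε)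

/-- The operator `𝒜_{ε,v}(D²v) = Δv + 2 α_ε'(|Dv|²) / α_ε(|Dv|²) · (D²v Dv · Dv)` at `x`. -/
noncomputable def opA {N : ℕ} (α : ℝ → ℝ) (ε : ℝ) (v : Euc N → ℝ) (x : Euc N) : ℝ :=
  Laplacian.laplacian v x +
    2 * deriv (regCoeff α ε) (‖gradient v x‖ ^ 2) / regCoeff α ε (‖gradient v x‖ ^ 2) *
      iteratedFDeriv ℝ 2 v x ![gradient v x, gradient v x]

/-! ### The domain -/

/-- `Ω` has a boundary of class `C¹`: near each boundary point it is the set where some `C¹`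
function with non-vanishing gradient is negative. -/
def HasC1Boundary {N : ℕ} (Ω : Set (Euc N)) : Prop :=
  ∀ x ∈ frontier Ω, ∃ (U : Set (Euc N)) (ρ : Euc N → ℝ),
    IsOpen U ∧ x ∈ U ∧ ContDiffOn ℝ 1 ρ U ∧ (∀ y ∈ U, gradient ρ y ≠ 0) ∧
      Ω ∩ U = {y ∈ U | ρ y < 0}

/-- `n` is an outward unit normal at `x` to the convex set `Ω`, that is, the unit normal of a
supporting half-space at `x`. At a boundary point of a convex domain with `C¹` boundary there is
exactly one. -/
def IsOutwardNormal {N : ℕ} (Ω : Set (Euc N)) (x n : Euc N) : Prop :=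
  ‖n‖ = 1 ∧ ∀ y ∈ Ω, inner ℝ n (y - x) ≤ 0

/-! ### Sobolev functions -/

/-- `g` is the weak gradient of `v` in the open set `Ω`. -/
def IsWeakGradient {N : ℕ} (Ω : Set (Euc N)) (v : Euc N → ℝ) (g : Euc N → Euc N) : Prop :=
  LocallyIntegrableOn v Ω ∧ LocallyIntegrableOn g Ω ∧
    ∀ φ : Euc N → ℝ, ContDiff ℝ ∞ φ → HasCompactSupport φ → tsupport φ ⊆ Ω →
      ∫ x in Ω, v x • gradient φ x = -∫ x in Ω, φ x • g x

/-- `v ∈ W^{1,m}(Ω)`, with weak gradient `g`. -/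
def MemW1 {N : ℕ} (m : ℝ≥0∞) (Ω : Set (Euc N)) (v : Euc N → ℝ) (g : Euc N → Euc N) : Prop :=
  MemLp v m (volume.restrict Ω) ∧ MemLp g m (volume.restrict Ω) ∧ IsWeakGradient Ω v g

/-! ### Solutions of the regularized Neumann problem -/

/-- The parabolic regularity of a smooth function `u(t, x)` on `(0, T) × Ω`: the space derivatives
up to order two are continuous up to the lateral boundary, and `D³u`, `∂ₜu`, `D∂ₜu` exist and are
continuous inside the cylinder. -/
structure IsParabolicSmooth {N : ℕ} (Ω : Set (Euc N)) (T : ℝ) (u : ℝ → Euc N → ℝ) : Prop where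
  contDiffOn_closure : ∀ t ∈ Ioo 0 T, ContDiffOn ℝ 2 (u t) (closure Ω)
  continuousOn_closure : ∀ k : ℕ, k ≤ 2 → ContinuousOn
    (fun z : ℝ × Euc N => iteratedFDerivWithin ℝ k (u z.1) (closure Ω) z.2)
    (Ioo 0 T ×ˢ closure Ω)
  contDiffOn_interior : ∀ t ∈ Ioo 0 T, ContDiffOn ℝ 3 (u t) Ω
  continuousOn_third : ContinuousOn
    (fun z : ℝ × Euc N => iteratedFDeriv ℝ 3 (u z.1) z.2) (Ioo 0 T ×ˢ Ω)
  differentiableAt_time : ∀ t ∈ Ioo 0 T, ∀ x ∈ Ω, DifferentiableAt ℝ (fun s => u s x) t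
  continuousOn_time : ContinuousOn
    (fun z : ℝ × Euc N => deriv (fun s => u s z.2) z.1) (Ioo 0 T ×ˢ Ω)
  contDiffOn_time : ∀ t ∈ Ioo 0 T, ContDiffOn ℝ 1 (fun x => deriv (fun s => u s x) t) Ω
  continuousOn_time_gradient : ContinuousOn
    (fun z : ℝ × Euc N => gradient (fun x => deriv (fun s => u s x) z.1) z.2) (Ioo 0 T ×ˢ Ω)

/-- `u` is a smooth solution of
`∂ₜu - α_ε(|Du|²) 𝒜_{ε,u}(D²u) = f` in `Ω × (0, T)`, `∂_ν u = 0` on `∂Ω × (0, T)`, `u(0) = u₀`.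
The initial datum `u₀`, with weak gradient `Du₀`, is attained in `W^{1,2}(Ω)` as `t → 0⁺`. -/
structure IsSolution {N : ℕ} (Ω : Set (Euc N)) (T : ℝ) (α : ℝ → ℝ) (ε : ℝ)
    (f : ℝ → Euc N → ℝ) (u₀ : Euc N → ℝ) (Du₀ : Euc N → Euc N)
    (u : ℝ → Euc N → ℝ) : Prop where
  smooth : IsParabolicSmooth Ω T u
  equation : ∀ t ∈ Ioo 0 T, ∀ x ∈ Ω,
    deriv (fun s => u s x) t -
      regCoeff α ε (‖gradient (u t) x‖ ^ 2) * opA α ε (u t) x = f t x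
  neumann : ∀ t ∈ Ioo 0 T, ∀ x ∈ frontier Ω, ∀ n, IsOutwardNormal Ω x n →
    inner ℝ (gradientWithin (u t) (closure Ω) x) n = 0
  initial : Tendsto (fun t => eLpNorm (fun x => u t x - u₀ x) 2 (volume.restrict Ω))
    (𝓝[>] 0) (𝓝 0)
  initial_gradient :
    Tendsto (fun t => eLpNorm (fun x => gradient (u t) x - Du₀ x) 2 (volume.restrict Ω))
      (𝓝[>] 0) (𝓝 0)

end QuasilinearNeumann

/-!
The estimate is the Bernstein method in integrated form. Write `V = Du`, `w = |V|²` and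
`F(ξ) = α_ε(|ξ|²) ξ`, so that the equation reads `∂ₜu = q + f` with `q = div F(V)`. The lower bound
on the index of `α` ensures that `DF(ξ)`, which is symmetric, is nonnegative. For a
nonnegative nondecreasing weight `g`, the field `Y = g(w) DF(V) DV V` satisfies
`div Y ≥ g(w) ⟨Dq, V⟩` (`le_divergence_weightedFlux`): the terms left out are
`2 g'(w) ⟨DF(V) DV V, DV V⟩` and `g(w) tr(DF(V) DV DV)`, both nonnegative.

At the boundary the normal is an eigenvector of `DF(V)`, since `V` is tangential, and
`⟨n, DV V⟩ ≤ 0` by convexity (`inner_fderivWithin_self_nonpos`), so `Y` does not point outward.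
As the boundary is only `C¹` and third derivatives of `u` are controlled only inside, the divergence
theorem is replaced by integration by parts against the Lipschitz cutoff
`cutoff Ω δ`, a function of the distance to the complement: where it is differentiable, its gradient
is a nonpositive multiple of the outward normal at the nearest boundary point, of size at most
`1 / δ`, and it vanishes outside a layer of volume `O(δ)`. Uniform continuity of `Y` up to the
boundary then makes the boundary contribution nonpositive as `δ → 0`
(`exists_setIntegral_cutoff_mul_divergence_le`,
`IsSolution.exists_setIntegral_cutoff_le`).

Consequently, for `G' = g`, the integral of `G(w)` changes in time at a rate at most
`∫ 2 g(w) ⟨V, Df⟩`. If `2 g(r²) r b ≤ (m - 1) G(r²) + b ^ m`, Gronwall's argument gives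
`∫ G(w(t)) ≤ e^((m-1)t) (∫ G(w(s)) + ∫∫ |Df|^m)` (`IsSolution.setIntegral_primitive_le`). The choice
`G(w) = w ^ (m/2)` is not available, because the initial gradient is attained in `L²` only. One
takes instead functions of linear growth in `w` which approximate it: `G' = (m/2) h^((m-2)/2)` with
`h` a bounded concave smooth truncation of the identity, for which concavity yields the same Young
inequality (`isWeight_truncatedWeight`). Letting first `s → 0` and then removing the truncation by
Fatou's lemma gives `‖Du(t)‖_m ≤ e^T (‖Df‖_m + ‖Du₀‖_m)` for finite `m`; since the constant does not
depend on `m` and the domain has finite measure, `m = ∞` follows by letting `m → ∞`.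
-/

namespace QuasilinearNeumann

/-! ### Convex domains: nearest points, outward normals, volume of the boundary layer -/

section

variable {N : ℕ} {Ω : Set (Euc N)}

theorem exists_pos_add_smul_mem (hΩ : IsOpen Ω) {z : Euc N} (hz : z ∈ Ω) (v : Euc N) :
    ∃ t : ℝ, 0 < t ∧ z + t • v ∈ Ω := by
  have hc : Tendsto (fun t : ℝ => z + t • v) (𝓝[>] 0) (𝓝 z) := by
    have : Continuous fun t : ℝ => z + t • v := by fun_prop
    simpa using (this.tendsto 0).mono_left nhdsWithin_le_nhds
  obtain ⟨t, ht, ht0⟩ := ((hc.eventually (hΩ.mem_nhds hz)).and self_mem_nhdsWithin).exists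
  exact ⟨t, ht0, ht⟩

theorem IsOutwardNormal.inner_neg (hΩ : IsOpen Ω) {y n z : Euc N} (hn : IsOutwardNormal Ω y n)
    (hz : z ∈ Ω) : inner ℝ n (z - y) < 0 := by
  obtain ⟨t, ht, htz⟩ := exists_pos_add_smul_mem hΩ hz n
  have h := hn.2 _ htz
  have e : inner ℝ n (z + t • n - y) = inner ℝ n (z - y) + t := by
    rw [show z + t • n - y = (z - y) + t • n by abel, inner_add_right, inner_smul_right,
      real_inner_self_eq_norm_sq, hn.1]
    ring
  linarith

theorem exists_isOutwardNormal (hΩ : IsOpen Ω) (hc : Convex ℝ Ω) (hne : Ω.Nonempty) {y : Euc N}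
    (hy : y ∉ Ω) : ∃ n, IsOutwardNormal Ω y n := by
  obtain ⟨f, hf⟩ := geometric_hahn_banach_open_point hc hΩ hy
  set a := (InnerProductSpace.toDual ℝ (Euc N)).symm f with ha
  have hfa : ∀ z, f z = inner ℝ a z := fun z => by
    rw [ha, InnerProductSpace.toDual_symm_apply]
  have ha0 : a ≠ 0 := by
    intro h0
    obtain ⟨z, hz⟩ := hne
    have := hf z hz
    simp [hfa, h0] at this
  have hpos : 0 < ‖a‖ := norm_pos_iff.2 ha0
  refine ⟨‖a‖⁻¹ • a, by rw [norm_smul, norm_inv, norm_norm, inv_mul_cancel₀ hpos.ne'], ?_⟩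
  intro z hz
  have := hf z hz
  rw [hfa, hfa] at this
  rw [real_inner_smul_left, inner_sub_right]
  exact mul_nonpos_of_nonneg_of_nonpos (by positivity) (by linarith)

/-- The nearest point `y` of the complement, seen from a point `x` of an open convex set: the
direction from `x` to `y` is an outward normal at `y`, and the supporting half-space bounds the
distance to the complement from above, with equality at `x`. -/
theorem exists_nearest_normal (hΩ : IsOpen Ω) (hc : Convex ℝ Ω) (hne : Ωᶜ.Nonempty) {x : Euc N}
    (hx : x ∈ Ω) : ∃ y ∈ frontier Ω, ∃ n, IsOutwardNormal Ω y n ∧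
      y - x = Metric.infDist x Ωᶜ • n ∧
      ∀ z ∈ Ω, Metric.infDist z Ωᶜ ≤ inner ℝ n (y - z) := by
  obtain ⟨y, hyΩ, hxy⟩ := hΩ.isClosed_compl.exists_infDist_eq_dist hne x
  set d := Metric.infDist x Ωᶜ with hd
  have hd0 : 0 < d := by
    rw [hd, ← hΩ.isClosed_compl.notMem_iff_infDist_pos hne]
    exact fun h => h hx
  have hball : Metric.ball x d ⊆ Ω := by
    have := Metric.ball_infDist_compl_subset (s := Ω) (x := x)
    exact this
  obtain ⟨n, hn⟩ := exists_isOutwardNormal hΩ hc ⟨x, hx⟩ hyΩ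
  have hnorm : ‖y - x‖ = d := by rw [hxy, dist_eq_norm, norm_sub_rev]
  have hle : d ≤ inner ℝ n (y - x) := by
    refine le_of_forall_lt_imp_le_of_dense fun r hr => ?_
    rcases lt_or_ge r 0 with h0 | h0
    · have := hn.inner_neg hΩ hx
      rw [← neg_sub, inner_neg_right]
      linarith
    have hmem : x + r • n ∈ Ω := hball (by
      rw [Metric.mem_ball, dist_eq_norm, add_sub_cancel_left, norm_smul, hn.1, mul_one,
        Real.norm_of_nonneg h0]
      exact hr)
    have h := hn.2 _ hmem
    rw [show x + r • n - y = r • n - (y - x) by abel, inner_sub_right, inner_smul_right,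
      real_inner_self_eq_norm_sq, hn.1] at h
    linarith
  have heq : inner ℝ n (y - x) = d := by
    refine le_antisymm ?_ hle
    have := real_inner_le_norm n (y - x)
    rwa [hn.1, hnorm, one_mul] at this
  have hyx : y - x = d • n := by
    have h0 : ‖(y - x) - d • n‖ ^ 2 = 0 := by
      rw [norm_sub_sq_real, hnorm, norm_smul, hn.1, inner_smul_right, real_inner_comm, heq,
        Real.norm_of_nonneg hd0.le]
      ring
    exact sub_eq_zero.1 (norm_eq_zero.1 (pow_eq_zero_iff two_ne_zero |>.1 h0))
  refine ⟨y, ?_, n, hn, hyx, ?_⟩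
  · rw [frontier, hΩ.interior_eq]
    refine ⟨?_, hyΩ⟩
    have : y ∈ closure (Metric.ball x d) := by
      rw [closure_ball _ hd0.ne', Metric.mem_closedBall, dist_eq_norm, hnorm]
    exact closure_mono hball this
  · intro z hz
    set s := inner ℝ n (y - z) with hs
    have hp : z + s • n ∉ Ω := by
      intro hp
      have := hn.inner_neg hΩ hp
      rw [show z + s • n - y = s • n - (y - z) by abel, inner_sub_right, inner_smul_right,
        real_inner_self_eq_norm_sq, hn.1] at this
      linarith
    have hs0 : 0 ≤ s := by
      have := hn.2 z hz
      rw [← neg_sub, inner_neg_right] at this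
      linarith
    calc Metric.infDist z Ωᶜ ≤ dist z (z + s • n) := Metric.infDist_le_dist_of_mem hp
      _ = s := by
        rw [dist_eq_norm, sub_add_cancel_left, norm_neg, norm_smul, hn.1, mul_one,
          Real.norm_of_nonneg hs0]

/-- An open convex set of finite volume is bounded: a far away point would span, together with a
small ball, a long row of disjoint balls of equal radius. -/
theorem isBounded_of_volume_lt_top (hΩ : IsOpen Ω) (hc : Convex ℝ Ω) (hne : Ω.Nonempty)
    (hvol : volume Ω < ⊤) : Bornology.IsBounded Ω := by
  obtain ⟨x₀, hx₀⟩ := hne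
  obtain ⟨r, hr, hball⟩ := Metric.isOpen_iff.1 hΩ x₀ hx₀
  have hb0 : volume (Metric.ball x₀ (r / 2)) ≠ 0 :=
    (Metric.measure_ball_pos volume x₀ (by positivity)).ne'
  have hbt : volume (Metric.ball x₀ (r / 2)) ≠ ⊤ := measure_ball_lt_top.ne
  have hq : volume Ω / volume (Metric.ball x₀ (r / 2)) ≠ ⊤ :=
    (ENNReal.div_lt_top hvol.ne hb0).ne
  obtain ⟨k, hk⟩ := ENNReal.exists_nat_gt hq
  refine (Metric.isBounded_iff_subset_closedBall x₀).2 ⟨2 * (k + 1) * r, fun x hx => ?_⟩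
  by_contra hfar
  rw [Metric.mem_closedBall, not_le, dist_eq_norm] at hfar
  set L := ‖x - x₀‖ with hL
  have hL0 : 0 < L := lt_trans (by positivity) hfar
  let c : ℕ → Euc N := fun i => x₀ + ((i : ℝ) * r / L) • (x - x₀)
  have hdist : ∀ i j : ℕ, dist (c i) (c j) = |(i : ℝ) - j| * r := fun i j => by
    simp only [c]
    rw [dist_eq_norm, add_sub_add_left_eq_sub, ← sub_smul, norm_smul, ← hL, Real.norm_eq_abs,
      ← sub_div, ← sub_mul, abs_div, abs_mul, abs_of_pos hL0, abs_of_pos hr]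
    field_simp
  have hdisj : ((Finset.range k : Set ℕ)).PairwiseDisjoint fun i => Metric.ball (c i) (r / 2) := by
    intro i _ j _ hij
    refine Metric.ball_disjoint_ball ?_
    rw [hdist]
    have h1 : (1 : ℝ) ≤ |(i : ℝ) - j| := by
      have : (1 : ℤ) ≤ |(i : ℤ) - j| := Int.one_le_abs (sub_ne_zero.2 (by exact_mod_cast hij))
      exact_mod_cast this
    nlinarith
  have hsub : (⋃ i ∈ Finset.range k, Metric.ball (c i) (r / 2)) ⊆ Ω := by
    refine iUnion₂_subset fun i hi z hz => ?_
    have hik : (i : ℝ) < k := by exact_mod_cast Finset.mem_range.1 hi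
    set θ := (i : ℝ) * r / L with hθ
    have hθ0 : 0 ≤ θ := by positivity
    have hθ1 : θ < 1 / 2 := by
      rw [hθ, div_lt_iff₀ hL0]
      nlinarith
    -- `z` is a convex combination of `x` and a point of the ball around `x₀`
    have hw : x₀ + (1 - θ)⁻¹ • (z - c i) ∈ Ω := hball (by
      rw [Metric.mem_ball, dist_eq_norm, add_sub_cancel_left, norm_smul, norm_inv,
        Real.norm_of_nonneg (by linarith), inv_mul_lt_iff₀ (by linarith), ← dist_eq_norm]
      have := Metric.mem_ball.1 hz
      nlinarith)
    have := hc hw hx (by linarith : (0 : ℝ) ≤ 1 - θ) hθ0 (by ring)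
    convert this using 1
    rw [smul_add, smul_smul, mul_inv_cancel₀ (by linarith), one_smul]
    simp only [c, ← hθ]
    module
  have hmeas : (k : ℝ≥0∞) * volume (Metric.ball x₀ (r / 2)) ≤ volume Ω := by
    calc (k : ℝ≥0∞) * volume (Metric.ball x₀ (r / 2))
        = ∑ i ∈ Finset.range k, volume (Metric.ball (c i) (r / 2)) := by
          simp [Measure.addHaar_ball_center]
      _ = volume (⋃ i ∈ Finset.range k, Metric.ball (c i) (r / 2)) :=
          (measure_biUnion_finset hdisj fun _ _ => measurableSet_ball).symm
      _ ≤ volume Ω := measure_mono hsub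
  rw [ENNReal.div_lt_iff (Or.inl hb0) (Or.inl hbt)] at hk
  exact absurd hmeas (not_le.2 hk)

theorem compl_nonempty_of_volume_lt_top (hN : 1 ≤ N) (hvol : volume Ω < ⊤) : Ωᶜ.Nonempty := by
  rw [nonempty_compl]
  rintro rfl
  have : Nonempty (Fin N) := ⟨⟨0, hN⟩⟩
  have : Nontrivial (Euc N) := inferInstance
  exact absurd hvol (by simp)

/-- The layer of width `δ` along the boundary of a convex set of finite volume has volume `O(δ)`:
it is missed by the homothetic copy of the set with ratio `1 - O(δ)`. -/
theorem exists_volume_layer_le (hΩ : IsOpen Ω) (hc : Convex ℝ Ω) (hne : Ω.Nonempty)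
    (hne' : Ωᶜ.Nonempty)
    (hvol : volume Ω < ⊤) : ∃ K : ℝ, 0 ≤ K ∧ ∃ δ₀ > 0, ∀ δ, 0 < δ → δ ≤ δ₀ →
      (volume {x ∈ Ω | Metric.infDist x Ωᶜ < δ}).toReal ≤ K * δ := by
  obtain ⟨x₀, hx₀⟩ := hne
  obtain ⟨r, hr, hball⟩ := Metric.isOpen_iff.1 hΩ x₀ hx₀
  refine ⟨(volume Ω).toReal * N / r, by positivity, r, hr, fun δ hδ hδr => ?_⟩
  set θ := δ / r with hθ
  have hθ0 : 0 < θ := by positivity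
  have hθ1 : θ ≤ 1 := (div_le_one hr).2 hδr
  set Ω' := AffineMap.homothety x₀ (1 - θ) '' Ω with hΩ'
  have hmem : ∀ z ∈ Ω', z ∈ Ω ∧ δ ≤ Metric.infDist z Ωᶜ := by
    rintro _ ⟨x, hx, rfl⟩
    have hsub : Metric.ball (AffineMap.homothety x₀ (1 - θ) x) δ ⊆ Ω := by
      intro z hz
      have hw : x₀ + θ⁻¹ • (z - AffineMap.homothety x₀ (1 - θ) x) ∈ Ω := hball (by
        rw [Metric.mem_ball, dist_eq_norm, add_sub_cancel_left, norm_smul, norm_inv,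
          Real.norm_of_nonneg hθ0.le, inv_mul_lt_iff₀ hθ0, ← dist_eq_norm]
        have := Metric.mem_ball.1 hz
        rwa [hθ, div_mul_cancel₀ _ hr.ne'])
      have := hc hw hx hθ0.le (by linarith : 0 ≤ 1 - θ) (by ring)
      convert this using 1
      rw [smul_add, smul_smul, mul_inv_cancel₀ hθ0.ne', one_smul]
      simp only [AffineMap.homothety_apply, vsub_eq_sub, vadd_eq_add]
      module
    refine ⟨hsub (Metric.mem_ball_self hδ), ?_⟩
    rw [Metric.le_infDist hne']
    intro y hy
    by_contra hlt
    exact hy (hsub (by rw [Metric.mem_ball, dist_comm]; exact not_le.1 hlt))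
  have hvol' : (volume Ω').toReal = (1 - θ) ^ N * (volume Ω).toReal := by
    rw [hΩ', Measure.addHaar_image_homothety, ENNReal.toReal_mul, finrank_euclideanSpace_fin,
      ENNReal.toReal_ofReal (abs_nonneg _), abs_of_nonneg (pow_nonneg (by linarith) _)]
  have hdisj : Disjoint {x ∈ Ω | Metric.infDist x Ωᶜ < δ} Ω' := by
    rw [Set.disjoint_left]
    exact fun z hz hz' => absurd hz.2 (not_lt.2 (hmem z hz').2)
  have hlay : MeasurableSet {x ∈ Ω | Metric.infDist x Ωᶜ < δ} :=
    (hΩ.inter (isOpen_lt (Metric.continuous_infDist_pt _) continuous_const)).measurableSet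
  have hunion : volume {x ∈ Ω | Metric.infDist x Ωᶜ < δ} + volume Ω' ≤ volume Ω := by
    rw [← measure_union' hdisj hlay]
    exact measure_mono (union_subset (sep_subset _ _) fun z hz => (hmem z hz).1)
  have hreal := ENNReal.toReal_mono hvol.ne hunion
  rw [ENNReal.toReal_add (ne_top_of_le_ne_top hvol.ne (le_trans le_self_add hunion))
    (ne_top_of_le_ne_top hvol.ne (le_trans le_add_self hunion)), hvol'] at hreal
  have hbern : 1 - N * θ ≤ (1 - θ) ^ N := by
    have := one_add_mul_le_pow (a := -θ) (by linarith) N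
    simpa [sub_eq_add_neg] using this
  calc _ ≤ (volume Ω).toReal * (1 - (1 - θ) ^ N) := by linarith
    _ ≤ (volume Ω).toReal * (N * θ) := by gcongr; linarith
    _ = _ := by rw [hθ]; ring

end

/-! ### Integration by parts with a Lipschitz cutoff -/

section

variable {N : ℕ} {Ω : Set (Euc N)}

/-- The divergence of a vector field, as the trace of its derivative. -/
noncomputable def divergence (Y : Euc N → Euc N) (x : Euc N) : ℝ :=
  LinearMap.trace ℝ (Euc N) (fderiv ℝ Y x).toLinearMap

theorem divergence_eq_sum (Y : Euc N → Euc N) (x : Euc N) :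
    divergence Y x = ∑ i, fderiv ℝ Y x (EuclideanSpace.basisFun (Fin N) ℝ i) i := by
  rw [divergence, LinearMap.trace_eq_sum_inner _ (EuclideanSpace.basisFun (Fin N) ℝ)]
  simp [EuclideanSpace.inner_single_left]

theorem continuousOn_divergence (hΩ : IsOpen Ω) {Y : Euc N → Euc N} (hY : ContDiffOn ℝ 1 Y Ω) :
    ContinuousOn (divergence Y) Ω := by
  have h := hY.continuousOn_fderiv_of_isOpen hΩ le_rfl
  rw [show divergence Y = fun x => ∑ i, fderiv ℝ Y x (EuclideanSpace.basisFun (Fin N) ℝ i) i from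
    funext (divergence_eq_sum Y)]
  refine continuousOn_finsetSum _ fun i _ => ?_
  exact (EuclideanSpace.proj (𝕜 := ℝ) i).continuous.comp_continuousOn
    (h.clm_apply continuousOn_const)

/-- Multiplication by a smooth cutoff that equals `1` near a compact subset `K` of the open set `Ω`
extends a `C¹` field from `Ω` to the whole space. -/
theorem exists_contDiff_extension (hΩ : IsOpen Ω) {K : Set (Euc N)} (hK : IsCompact K)
    (hKΩ : K ⊆ Ω) {Y : Euc N → Euc N} (hY : ContDiffOn ℝ 1 Y Ω) :
    ∃ W : Euc N → Euc N, ContDiff ℝ 1 W ∧ HasCompactSupport W ∧ ∀ x ∈ K, W =ᶠ[𝓝 x] Y := by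
  obtain ⟨L, hL, hKL, hLΩ⟩ := exists_compact_between hK hΩ hKΩ
  obtain ⟨χ, h1, h0, -⟩ := exists_contMDiffMap_one_nhds_of_subset_interior
    (modelWithCornersSelf ℝ (Euc N)) (n := 1) hK.isClosed hKL
  have hχ : ContDiff ℝ 1 (χ : Euc N → ℝ) := χ.contMDiff.contDiff
  refine ⟨fun x => χ x • Y x, ?_, ?_, ?_⟩
  · refine contDiff_iff_contDiffAt.2 fun x => ?_
    by_cases hx : x ∈ Ω
    · exact hχ.contDiffAt.smul (hY.contDiffAt (hΩ.mem_nhds hx))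
    · have : (fun x => χ x • Y x) =ᶠ[𝓝 x] fun _ => 0 := by
        filter_upwards [hL.isClosed.isOpen_compl.mem_nhds fun h => hx (hLΩ h)] with z hz
        rw [h0 z hz, zero_smul]
      exact contDiffAt_const.congr_of_eventuallyEq this
  · exact HasCompactSupport.intro hL fun x hx => by rw [h0 x hx, zero_smul]
  · intro x hx
    filter_upwards [Filter.Eventually.filter_mono (nhds_le_nhdsSet hx) h1] with z hz
    rw [hz, one_smul]

/-- Integration by parts of a `C¹` field in `Ω` against a Lipschitz function with compact support in
`Ω`, whose derivative exists almost everywhere by Rademacher's theorem. -/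
theorem integral_mul_divergence (hΩ : IsOpen Ω) {Y : Euc N → Euc N} (hY : ContDiffOn ℝ 1 Y Ω)
    {η : Euc N → ℝ} {C : ℝ≥0} (hη : LipschitzWith C η) (hcs : HasCompactSupport η)
    (hsub : tsupport η ⊆ Ω) :
    ∫ x, η x * divergence Y x = -∫ x, fderiv ℝ η x (Y x) := by
  obtain ⟨W, hW, hWc, hWY⟩ := exists_contDiff_extension hΩ hcs hsub hY
  set e := EuclideanSpace.basisFun (Fin N) ℝ with he
  have hWi : ∀ i, ContDiff ℝ 1 fun x => W x i := fun i =>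
    (EuclideanSpace.proj (𝕜 := ℝ) i).contDiff.comp hW
  have hWic : ∀ i, HasCompactSupport fun x => W x i := fun i =>
    hWc.comp_left (g := fun v : Euc N => v i) rfl
  have hWid : ∀ i x, fderiv ℝ (fun x => W x i) x (e i) = fderiv ℝ W x (e i) i := fun i x => by
    have := ((EuclideanSpace.proj (𝕜 := ℝ) i).hasFDerivAt.comp x
      ((hW.differentiable one_ne_zero x).hasFDerivAt)).fderiv
    rw [Function.comp_def] at this
    change fderiv ℝ (fun x => (EuclideanSpace.proj (𝕜 := ℝ) i) (W x)) x (e i) = _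
    rw [this]
    simp
  have key : ∀ i, ∫ x, lineDeriv ℝ η x (e i) * W x i =
      -∫ x, η x * fderiv ℝ W x (e i) i := fun i => by
    obtain ⟨D, hD⟩ := (hWi i).lipschitzWith_of_hasCompactSupport (hWic i) one_ne_zero
    rw [hη.integral_lineDeriv_mul_eq hD (hWic i), ← integral_neg]
    refine integral_congr_ae (ae_of_all _ fun x => ?_)
    have hd : DifferentiableAt ℝ (fun x => W x i) x := (hWi i).differentiable one_ne_zero x
    simp only
    rw [hd.lineDeriv_eq_fderiv, map_neg, hWid]
    ring
  have hfd : ∀ x ∉ tsupport η, fderiv ℝ η x = 0 := fun x hx => by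
    rw [(notMem_tsupport_iff_eventuallyEq.1 hx).fderiv_eq]
    exact fderiv_const_apply 0
  calc ∫ x, η x * divergence Y x = ∫ x, ∑ i, η x * fderiv ℝ W x (e i) i := by
        refine integral_congr_ae (ae_of_all _ fun x => ?_)
        simp only
        by_cases hx : x ∈ tsupport η
        · rw [divergence_eq_sum, Finset.mul_sum, (hWY x hx).fderiv_eq]
        · rw [image_eq_zero_of_notMem_tsupport hx]
          simp
    _ = ∑ i, ∫ x, η x * fderiv ℝ W x (e i) i := by
        refine integral_finsetSum _ fun i _ => ?_
        refine Continuous.integrable_of_hasCompactSupport ?_ hcs.mul_right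
        refine hη.continuous.mul ?_
        exact (EuclideanSpace.proj (𝕜 := ℝ) i).continuous.comp
          ((hW.continuous_fderiv one_ne_zero).clm_apply continuous_const)
    _ = -∑ i, ∫ x, lineDeriv ℝ η x (e i) * W x i := by
        rw [← Finset.sum_neg_distrib]
        exact Finset.sum_congr rfl fun i _ => by rw [key, neg_neg]
    _ = -∫ x, ∑ i, lineDeriv ℝ η x (e i) * W x i := by
        rw [integral_finsetSum _ fun i _ => ?_]
        exact (hη.locallyIntegrable_lineDeriv (e i)).integrable_smul_right_of_hasCompactSupport
          (hWi i).continuous (hWic i)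
    _ = -∫ x, fderiv ℝ η x (Y x) := by
        congr 1
        refine integral_congr_ae ?_
        filter_upwards [hη.ae_differentiableAt (μ := volume)] with x hx
        by_cases hxs : x ∈ tsupport η
        · rw [← (hWY x hxs).eq_of_nhds]
          conv_rhs => rw [← e.sum_repr (W x), map_sum]
          refine Finset.sum_congr rfl fun i _ => ?_
          rw [hx.lineDeriv_eq_fderiv, map_smul, smul_eq_mul, mul_comm]
          simp [he]
        · simp [hx.lineDeriv_eq_fderiv, hfd x hxs]

/-- The cutoff of width `δ` along the boundary of `Ω`: it vanishes at distance at most `δ` from the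
complement, equals `1` at distance at least `2δ`, and is affine in the distance in between. -/
noncomputable def cutoff (Ω : Set (Euc N)) (δ : ℝ) (x : Euc N) : ℝ :=
  max 0 (min 1 (Metric.infDist x Ωᶜ / δ - 1))

theorem cutoff_nonneg (Ω : Set (Euc N)) (δ : ℝ) (x : Euc N) : 0 ≤ cutoff Ω δ x := le_max_left _ _

theorem cutoff_le_one (Ω : Set (Euc N)) (δ : ℝ) (x : Euc N) : cutoff Ω δ x ≤ 1 :=
  max_le zero_le_one (min_le_left _ _)

theorem cutoff_eq_one {δ : ℝ} (hδ : 0 < δ) {x : Euc N} (hx : 2 * δ ≤ Metric.infDist x Ωᶜ) :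
    cutoff Ω δ x = 1 := by
  have : (1 : ℝ) ≤ Metric.infDist x Ωᶜ / δ - 1 := by
    rw [le_sub_iff_add_le, le_div_iff₀ hδ]; linarith
  rw [cutoff, min_eq_left this, max_eq_right zero_le_one]

theorem cutoff_eq_zero {δ : ℝ} (hδ : 0 < δ) {x : Euc N} (hx : Metric.infDist x Ωᶜ ≤ δ) :
    cutoff Ω δ x = 0 := by
  have : Metric.infDist x Ωᶜ / δ - 1 ≤ 0 := by
    rw [sub_nonpos, div_le_one hδ]; exact hx
  rw [cutoff, max_eq_left ((min_le_right _ _).trans this)]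

theorem lipschitzWith_cutoff (Ω : Set (Euc N)) {δ : ℝ} (hδ : 0 < δ) :
    LipschitzWith (Real.toNNReal δ⁻¹) (cutoff Ω δ) := by
  have h1 : LipschitzWith (Real.toNNReal δ⁻¹) fun x : Euc N => Metric.infDist x Ωᶜ / δ - 1 := by
    refine LipschitzWith.of_dist_le_mul fun x y => ?_
    have h := (Metric.lipschitz_infDist_pt Ωᶜ).dist_le_mul x y
    rw [Real.dist_eq] at h ⊢
    rw [sub_sub_sub_cancel_right, ← sub_div, abs_div, abs_of_pos hδ,
      Real.coe_toNNReal _ (inv_nonneg.2 hδ.le), div_eq_inv_mul]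
    gcongr
    simpa using h
  exact (h1.const_min 1).const_max 0

theorem tsupport_cutoff_subset {δ : ℝ} (hδ : 0 < δ) :
    tsupport (cutoff Ω δ) ⊆ {x | δ ≤ Metric.infDist x Ωᶜ} := by
  refine closure_minimal (fun x hx => ?_)
    (isClosed_le continuous_const (Metric.continuous_infDist_pt _))
  by_contra h
  exact hx (cutoff_eq_zero hδ (not_le.1 h).le)

theorem tsupport_cutoff_subset_self {δ : ℝ} (hδ : 0 < δ) : tsupport (cutoff Ω δ) ⊆ Ω := by
  intro x hx
  by_contra h
  have := tsupport_cutoff_subset hδ hx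
  rw [mem_ofPred_eq, Metric.infDist_zero_of_mem h] at this
  linarith

theorem hasCompactSupport_cutoff (hb : Bornology.IsBounded Ω) {δ : ℝ} (hδ : 0 < δ) :
    HasCompactSupport (cutoff Ω δ) :=
  Metric.isCompact_of_isClosed_isBounded (isClosed_tsupport _)
    (hb.subset (tsupport_cutoff_subset_self hδ))

theorem cutoff_eq_zero_of_notMem {δ : ℝ} (hδ : 0 < δ) {x : Euc N} (hx : x ∉ Ω) :
    cutoff Ω δ x = 0 :=
  image_eq_zero_of_notMem_tsupport fun h => hx (tsupport_cutoff_subset_self hδ h)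

/-- Near the boundary the cutoff decreases at a rate at most `β / δ` in a direction whose component
along the outward normals at nearby boundary points is at most `β`. -/
theorem neg_fderiv_cutoff_le (hΩ : IsOpen Ω) (hc : Convex ℝ Ω) (hne : Ωᶜ.Nonempty) {δ β : ℝ}
    (hδ : 0 < δ) (hβ : 0 ≤ β) {x : Euc N} (hx : x ∈ Ω) {v : Euc N}
    (hv : ∀ y ∈ frontier Ω, ∀ n, IsOutwardNormal Ω y n → ‖y - x‖ ≤ 2 * δ → inner ℝ n v ≤ β)
    (hd : DifferentiableAt ℝ (cutoff Ω δ) x) :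
    -fderiv ℝ (cutoff Ω δ) x v ≤
      {x ∈ Ω | Metric.infDist x Ωᶜ < 3 * δ}.indicator (fun _ => β / δ) x := by
  rcases le_or_gt (Metric.infDist x Ωᶜ) (2 * δ) with hle | hgt
  · rw [indicator_of_mem (by exact ⟨hx, by linarith⟩)]
    obtain ⟨y, hy, n, hn, hyx, hmax⟩ := exists_nearest_normal hΩ hc hne hx
    set d := Metric.infDist x Ωᶜ with hdd
    have hd0 : 0 ≤ d := Metric.infDist_nonneg
    have hnv : inner ℝ n v ≤ β := hv y hy n hn (by
      rw [hyx, norm_smul, hn.1, mul_one, Real.norm_of_nonneg hd0]; exact hle)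
    have hder : HasDerivAt (fun t : ℝ => cutoff Ω δ (x + t • -v))
        (fderiv ℝ (cutoff Ω δ) x (-v)) 0 := by
      have := hd.hasFDerivAt.hasLineDerivAt (-v)
      exact this
    have hslope := (hasDerivAt_iff_tendsto_slope.1 hder).mono_left
      (nhdsWithin_mono 0 fun t (ht : t ∈ Ioi (0 : ℝ)) => (mem_Ioi.1 ht).ne')
    rw [← map_neg]
    refine le_of_tendsto hslope ?_
    have hin : ∀ᶠ t in 𝓝[>] (0 : ℝ), x + t • -v ∈ Ω := by
      have hc : Continuous fun t : ℝ => x + t • -v := by fun_prop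
      exact nhdsWithin_le_nhds (hc.continuousAt.preimage_mem_nhds
        (by simpa using hΩ.mem_nhds hx))
    filter_upwards [hin, self_mem_nhdsWithin] with t htΩ ht
    have ht0 : 0 < t := ht
    have h1 : Metric.infDist (x + t • -v) Ωᶜ ≤ d + t * β := by
      refine (hmax _ htΩ).trans ?_
      rw [show y - (x + t • -v) = d • n + t • v by rw [← hyx]; module, inner_add_right,
        inner_smul_right, inner_smul_right, real_inner_self_eq_norm_sq, hn.1]
      nlinarith
    have h2 : cutoff Ω δ (x + t • -v) ≤ cutoff Ω δ x + t * (β / δ) := by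
      have hb : Metric.infDist (x + t • -v) Ωᶜ / δ - 1 ≤ (d / δ - 1) + t * (β / δ) := by
        have : Metric.infDist (x + t • -v) Ωᶜ / δ ≤ (d + t * β) / δ := by gcongr
        rw [add_div, mul_div_assoc] at this
        linarith
      have hp : 0 ≤ t * (β / δ) := by positivity
      rw [cutoff, cutoff]
      refine max_le (add_nonneg (le_max_left _ _) hp) ?_
      rcases le_total 1 (d / δ - 1) with h | h
      · rw [min_eq_left h, max_eq_right zero_le_one]
        exact (min_le_left _ _).trans (by linarith)
      · rw [min_eq_right h]
        exact (min_le_right _ _).trans (hb.trans (by gcongr; exact le_max_right _ _))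
    rw [slope_def_field, sub_zero, div_le_iff₀ ht0]
    simp only [zero_smul, add_zero]
    linarith
  · have : cutoff Ω δ =ᶠ[𝓝 x] fun _ => 1 := by
      filter_upwards [(Metric.continuous_infDist_pt Ωᶜ).continuousAt.eventually
        (lt_mem_nhds hgt)] with z hz
      exact cutoff_eq_one hδ (le_of_lt hz)
    rw [this.fderiv_eq, fderiv_const_apply]
    simp only [zero_apply, neg_zero]
    exact indicator_nonneg (fun _ _ => by positivity) _

/-- A quantitative divergence inequality on a convex domain: a `C¹` field in the interior whose
normal component near the boundary is at most `β` has localized flux at most `K β`. -/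
theorem exists_setIntegral_cutoff_mul_divergence_le (hΩ : IsOpen Ω) (hc : Convex ℝ Ω)
    (hne : Ω.Nonempty) (hne' : Ωᶜ.Nonempty) (hvol : volume Ω < ⊤) :
    ∃ K : ℝ, 0 ≤ K ∧ ∃ δ₀ > 0, ∀ δ, 0 < δ → δ ≤ δ₀ → ∀ β, 0 ≤ β → ∀ Y : Euc N → Euc N,
      ContDiffOn ℝ 1 Y Ω →
      (∀ x ∈ Ω, ∀ y ∈ frontier Ω, ∀ n, IsOutwardNormal Ω y n → ‖y - x‖ ≤ 2 * δ →
        inner ℝ n (Y x) ≤ β) →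
      ∫ x in Ω, cutoff Ω δ x * divergence Y x ≤ K * β := by
  obtain ⟨K, hK, δ₀, hδ₀, hlay⟩ := exists_volume_layer_le hΩ hc hne hne' hvol
  have hb := isBounded_of_volume_lt_top hΩ hc hne hvol
  refine ⟨K * 3, by positivity, δ₀ / 3, by positivity, fun δ hδ hδ' β hβ Y hY hn => ?_⟩
  set S := {x ∈ Ω | Metric.infDist x Ωᶜ < 3 * δ} with hS
  have hSm : MeasurableSet S :=
    (hΩ.inter (isOpen_lt (Metric.continuous_infDist_pt _) continuous_const)).measurableSet
  have hSv : volume S ≠ ⊤ := ne_top_of_le_ne_top hvol.ne (measure_mono (sep_subset _ _))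
  rw [setIntegral_eq_integral_of_forall_compl_eq_zero fun x hx => by
    rw [cutoff_eq_zero_of_notMem hδ hx, zero_mul]]
  rw [integral_mul_divergence hΩ hY (lipschitzWith_cutoff Ω hδ) (hasCompactSupport_cutoff hb hδ)
    (tsupport_cutoff_subset_self hδ), ← integral_neg]
  have hSle := hlay (3 * δ) (by positivity) (by linarith)
  have hint : ∫ x, S.indicator (fun _ => β / δ) x = (volume S).toReal * (β / δ) := by
    rw [integral_indicator hSm, setIntegral_const, smul_eq_mul, Measure.real]
  calc ∫ x, -fderiv ℝ (cutoff Ω δ) x (Y x) ≤ ∫ x, S.indicator (fun _ => β / δ) x := by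
        by_cases hi : Integrable fun x => -fderiv ℝ (cutoff Ω δ) x (Y x)
        · refine integral_mono_ae hi ?_ ?_
          · exact (integrable_indicator_iff hSm).2 (integrableOn_const hSv)
          · filter_upwards [(lipschitzWith_cutoff Ω hδ).ae_differentiableAt (μ := volume)] with x hd
            by_cases hx : x ∈ Ω
            · exact neg_fderiv_cutoff_le hΩ hc hne' hδ hβ hx (hn x hx) hd
            · have h0 : fderiv ℝ (cutoff Ω δ) x = 0 := by
                rw [(notMem_tsupport_iff_eventuallyEq.1
                  fun h => hx (tsupport_cutoff_subset_self hδ h)).fderiv_eq]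
                exact fderiv_const_apply 0
              simp only [h0, zero_apply, neg_zero]
              exact indicator_nonneg (fun _ _ => by positivity) _
        · rw [integral_undef hi]
          exact integral_nonneg fun x => indicator_nonneg (fun _ _ => by positivity) _
    _ = (volume S).toReal * (β / δ) := hint
    _ ≤ (K * (3 * δ)) * (β / δ) := by gcongr
    _ = K * 3 * β := by field_simp

end

/-! ### Convexity and tangential fields at a boundary of class `C¹` -/

section

variable {N : ℕ} {Ω : Set (Euc N)}

theorem IsOutwardNormal.inner_nonpos_of_mem_closure {y n z : Euc N} (hn : IsOutwardNormal Ω y n)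
    (hz : z ∈ closure Ω) : inner ℝ n (z - y) ≤ 0 := by
  have hcl : IsClosed {z : Euc N | inner ℝ n (z - y) ≤ 0} :=
    isClosed_le (by fun_prop) continuous_const
  exact closure_minimal (fun z hz => hn.2 z hz) hcl hz

/-- Directions along which the defining function decreases point into the domain. -/
theorem eventually_add_smul_mem {U : Set (Euc N)} {ρ : Euc N → ℝ} (hU : IsOpen U)
    (hρ : ContDiffOn ℝ 1 ρ U) (hΩU : Ω ∩ U = {y ∈ U | ρ y < 0}) {z : Euc N} (hzU : z ∈ U)
    (hz : z ∈ closure Ω) {v : Euc N} (hv : inner ℝ (gradient ρ z) v < 0) :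
    ∀ᶠ s in 𝓝[>] (0 : ℝ), z + s • v ∈ Ω := by
  have hd : DifferentiableAt ℝ ρ z := (hρ.contDiffAt (hU.mem_nhds hzU)).differentiableAt one_ne_zero
  have hz0 : ρ z ≤ 0 := by
    by_contra hpos
    obtain ⟨w, hw, hwΩ⟩ := (mem_closure_iff_nhds.1 hz) _
      ((hd.continuousAt.eventually (lt_mem_nhds (not_le.1 hpos))).and (hU.mem_nhds hzU))
    have : w ∈ {y ∈ U | ρ y < 0} := hΩU ▸ ⟨hwΩ, hw.2⟩
    exact absurd this.2 (not_lt.2 hw.1.le)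
  have hder : HasDerivAt (fun s : ℝ => ρ (z + s • v)) (inner ℝ (gradient ρ z) v) 0 := by
    rw [inner_gradient_left]
    exact hd.hasFDerivAt.hasLineDerivAt v
  have hslope := (hasDerivAt_iff_tendsto_slope.1 hder).mono_left
    (nhdsWithin_mono 0 fun t (ht : t ∈ Ioi (0 : ℝ)) => (mem_Ioi.1 ht).ne')
  have hin : ∀ᶠ t in 𝓝[>] (0 : ℝ), z + t • v ∈ U := by
    have hc : Continuous fun t : ℝ => z + t • v := by fun_prop
    exact nhdsWithin_le_nhds (hc.continuousAt.preimage_mem_nhds (by simpa using hU.mem_nhds hzU))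
  filter_upwards [hin, self_mem_nhdsWithin, hslope.eventually (gt_mem_nhds hv)] with t htU ht hts
  have ht0 : (0 : ℝ) < t := ht
  rw [slope_def_field, sub_zero, div_neg_iff] at hts
  simp only [zero_smul, add_zero] at hts
  have : z + t • v ∈ {y ∈ U | ρ y < 0} := ⟨htU, by
    rcases hts with h | h
    · linarith [h.2]
    · linarith [h.1]⟩
  exact (hΩU ▸ this : z + t • v ∈ Ω ∩ U).1

/-- The outward normal is the normalized gradient of the defining function. -/
theorem IsOutwardNormal.eq_smul_gradient {U : Set (Euc N)} {ρ : Euc N → ℝ}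
    (hU : IsOpen U) (hρ : ContDiffOn ℝ 1 ρ U) (hρ0 : ∀ y ∈ U, gradient ρ y ≠ 0)
    (hΩU : Ω ∩ U = {y ∈ U | ρ y < 0}) {z n : Euc N} (hzU : z ∈ U)
    (hz : z ∈ closure Ω) (hn : IsOutwardNormal Ω z n) :
    n = ‖gradient ρ z‖⁻¹ • gradient ρ z := by
  set p := gradient ρ z with hp
  have hp0 : 0 < ‖p‖ := norm_pos_iff.2 (hρ0 z hzU)
  set q := ‖p‖⁻¹ • p with hq
  have hq1 : ‖q‖ = 1 := by rw [hq, norm_smul, norm_inv, norm_norm, inv_mul_cancel₀ hp0.ne']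
  have key : ∀ v, inner ℝ q v < 0 → inner ℝ n v ≤ 0 := by
    intro v hv
    rw [hq, real_inner_smul_left] at hv
    have hv' : inner ℝ p v < 0 := by
      by_contra h
      exact absurd hv (not_lt.2 (mul_nonneg (by positivity) (not_lt.1 h)))
    obtain ⟨t, ht, ht0⟩ := ((eventually_add_smul_mem hU hρ hΩU hzU hz hv').and
      self_mem_nhdsWithin).exists
    have := hn.2 _ ht
    rw [add_sub_cancel_left, inner_smul_right] at this
    exact nonpos_of_mul_nonpos_right this ht0
  set a := inner ℝ n q with ha
  have hca : ∀ c, a < c → 1 ≤ c * a := by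
    intro c hc
    have := key (n - c • q) (by
      rw [inner_sub_right, inner_smul_right, real_inner_self_eq_norm_sq, hq1, real_inner_comm]
      linarith)
    rw [inner_sub_right, inner_smul_right, real_inner_self_eq_norm_sq, hn.1] at this
    linarith
  have ha0 : 0 ≤ a := by
    by_contra h
    have := hca 0 (not_le.1 h)
    linarith
  have ha1 : 1 ≤ a := by
    by_contra h
    have := hca 1 (not_le.1 h)
    linarith
  have h0 : ‖n - q‖ ^ 2 ≤ 0 := by
    rw [norm_sub_sq_real, hn.1, hq1, ← ha]
    linarith
  exact sub_eq_zero.1 (norm_eq_zero.1 (pow_eq_zero_iff two_ne_zero |>.1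
    (le_antisymm h0 (sq_nonneg _))))

/-- The outward normals at boundary points close to `y` are close to the normal at `y`. -/
theorem IsOutwardNormal.eventually_norm_sub_le (hC1 : HasC1Boundary Ω) {y n : Euc N}
    (hy : y ∈ frontier Ω) (hn : IsOutwardNormal Ω y n) {δ : ℝ} (hδ : 0 < δ) :
    ∀ᶠ z in 𝓝 y, z ∈ frontier Ω → ∀ n', IsOutwardNormal Ω z n' → ‖n' - n‖ ≤ δ := by
  obtain ⟨U, ρ, hU, hyU, hρ, hρ0, hΩU⟩ := hC1 y hy
  have hg : ContinuousAt (gradient ρ) y := by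
    have h1 : ContinuousAt (fderiv ℝ ρ) y :=
      (hρ.continuousOn_fderiv_of_isOpen hU le_rfl).continuousAt (hU.mem_nhds hyU)
    exact (InnerProductSpace.toDual ℝ (Euc N)).symm.continuous.continuousAt.comp h1
  have hc : ContinuousAt (fun z => ‖gradient ρ z‖⁻¹ • gradient ρ z) y :=
    (hg.norm.inv₀ (norm_ne_zero_iff.2 (hρ0 y hyU))).smul hg
  filter_upwards [hU.mem_nhds hyU, hc.eventually (Metric.closedBall_mem_nhds _ hδ)]
    with z hzU hz hzf n' hn'
  rw [hn'.eq_smul_gradient hU hρ hρ0 hΩU hzU (frontier_subset_closure hzf),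
    hn.eq_smul_gradient hU hρ hρ0 hΩU hyU (frontier_subset_closure hy), ← dist_eq_norm]
  exact hz

/-- From a boundary point one can follow a tangential direction along the boundary up to a
superlinear correction in the inner normal direction. -/
theorem IsOutwardNormal.eventually_exists_mem_frontier (hΩ : IsOpen Ω) (hC1 : HasC1Boundary Ω)
    {y n v : Euc N} (hy : y ∈ frontier Ω) (hn : IsOutwardNormal Ω y n) (hv : inner ℝ n v = 0)
    {δ : ℝ} (hδ : 0 < δ) :
    ∀ᶠ s in 𝓝[>] (0 : ℝ), ∃ r, 0 ≤ r ∧ r ≤ δ * s ∧ y + s • v - r • n ∈ frontier Ω := by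
  obtain ⟨U, ρ, hU, hyU, hρ, hρ0, hΩU⟩ := hC1 y hy
  have hdir : inner ℝ (gradient ρ y) (v - δ • n) < 0 := by
    have h := hn.eq_smul_gradient hU hρ hρ0 hΩU hyU (frontier_subset_closure hy)
    have hp0 : 0 < ‖gradient ρ y‖ := norm_pos_iff.2 (hρ0 y hyU)
    have h' : gradient ρ y = ‖gradient ρ y‖ • n := by
      conv_rhs => rw [h]
      rw [smul_smul, mul_inv_cancel₀ hp0.ne', one_smul]
    rw [h', real_inner_smul_left, inner_sub_right, hv, inner_smul_right,
      real_inner_self_eq_norm_sq, hn.1]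
    nlinarith
  filter_upwards [eventually_add_smul_mem hU hρ hΩU hyU (frontier_subset_closure hy) hdir,
    self_mem_nhdsWithin] with s hs hs0
  have hs0' : (0 : ℝ) < s := hs0
  have hout : y + s • v ∉ Ω := fun h => by
    have := hn.inner_neg hΩ h
    rw [add_sub_cancel_left, inner_smul_right, hv, mul_zero] at this
    exact lt_irrefl _ this
  let γ : ℝ → Euc N := fun r => y + s • v - r • n
  have hγ : Continuous γ := by fun_prop
  have hpre : IsPreconnected (γ '' Icc 0 (δ * s)) :=
    isPreconnected_Icc.image _ hγ.continuousOn
  have h1 : (γ '' Icc 0 (δ * s) ∩ Ω).Nonempty :=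
    ⟨γ (δ * s), mem_image_of_mem _ ⟨by positivity, le_rfl⟩, by
      convert hs using 1
      simp only [γ]
      module⟩
  have h2 : (γ '' Icc 0 (δ * s) ∩ Ωᶜ).Nonempty :=
    ⟨γ 0, mem_image_of_mem _ ⟨le_rfl, by positivity⟩, by simpa [γ] using hout⟩
  by_contra hno
  have hcov : γ '' Icc 0 (δ * s) ⊆ Ω ∪ (closure Ω)ᶜ := by
    rintro _ ⟨r, hr, rfl⟩
    by_contra hout'
    rw [mem_union, not_or, mem_compl_iff, not_not] at hout'
    refine hno ⟨r, hr.1, hr.2, hout'.2, ?_⟩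
    rw [hΩ.interior_eq]
    exact hout'.1
  have h2' : (γ '' Icc 0 (δ * s) ∩ (closure Ω)ᶜ).Nonempty := by
    obtain ⟨z, hz, hzΩ⟩ := h2
    exact ⟨z, hz, (hcov hz).resolve_left hzΩ⟩
  obtain ⟨z, -, hz1, hz2⟩ := hpre _ _ hΩ isClosed_closure.isOpen_compl hcov h1 h2'
  exact hz2 (subset_closure hz1)

/-- The convexity inequality at the boundary: if the field `V` is tangential to the boundary of a
convex domain, then its derivative in the direction of `V` itself does not point outward. The
curvature of the boundary is never formed, so `C¹` regularity is enough: one compares with the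
values of `V` at boundary points `y + sV(y) - o(s)n`. -/
theorem inner_fderivWithin_self_nonpos (hΩ : IsOpen Ω) (hc : Convex ℝ Ω) (hne : Ω.Nonempty)
    (hC1 : HasC1Boundary Ω) {V : Euc N → Euc N}
    (hV : ∀ z ∈ frontier Ω, ∀ n, IsOutwardNormal Ω z n → inner ℝ (V z) n = 0) {y n : Euc N}
    (hy : y ∈ frontier Ω) (hn : IsOutwardNormal Ω y n)
    (hd : DifferentiableWithinAt ℝ V (closure Ω) y) :
    inner ℝ n (fderivWithin ℝ V (closure Ω) y (V y)) ≤ 0 := by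
  set S := fderivWithin ℝ V (closure Ω) y with hS
  set v := V y with hv
  have hnv : inner ℝ n v = 0 := by rw [real_inner_comm]; exact hV y hy n hn
  set M := ‖S‖ + ‖v‖ + 1 + ‖S v‖ with hM
  have hM0 : 0 < M := by positivity
  have key : ∀ δ, 0 < δ → δ ≤ 1 → inner ℝ n (S v) ≤ δ * M := by
    intro δ hδ hδ1
    have hdiff := (hd.hasFDerivWithinAt.isLittleO.def hδ)
    rw [← hS] at hdiff
    have hnear := (eventually_nhdsWithin_iff.1 hdiff).and
      (hn.eventually_norm_sub_le hC1 hy hδ)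
    obtain ⟨R, hR, hball⟩ := Metric.eventually_nhds_iff.1 hnear
    have hsmall : ∀ᶠ s in 𝓝[>] (0 : ℝ), s * (‖v‖ + 1) < R := by
      have hcont : Continuous fun s : ℝ => s * (‖v‖ + 1) := by fun_prop
      exact nhdsWithin_le_nhds (hcont.continuousAt.eventually (gt_mem_nhds (by simpa using hR)))
    obtain ⟨s, ⟨⟨r, hr0, hr, hz⟩, hsR⟩, hs0⟩ :=
      (((hn.eventually_exists_mem_frontier hΩ hC1 hy hnv hδ).and hsmall).and
        self_mem_nhdsWithin).exists
    have hs : (0 : ℝ) < s := hs0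
    set z := y + s • v - r • n with hzdef
    have hzy : z - y = s • v - r • n := by rw [hzdef]; abel
    have hznorm : ‖z - y‖ ≤ s * (‖v‖ + 1) := by
      rw [hzy]
      refine (norm_sub_le _ _).trans ?_
      rw [norm_smul, norm_smul, hn.1, Real.norm_of_nonneg hs.le, Real.norm_of_nonneg hr0]
      nlinarith
    obtain ⟨hlin, hnor⟩ := hball (show dist z y < R by
      rw [dist_eq_norm]; exact hznorm.trans_lt hsR)
    have hzΩ : z ∉ Ω := by
      have := hz.2
      rwa [hΩ.interior_eq] at this
    obtain ⟨n', hn'⟩ := exists_isOutwardNormal hΩ hc hne hzΩ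
    have hnn := hnor hz n' hn'
    have hlin' := hlin (frontier_subset_closure hz)
    have hzero : inner ℝ n' (V z) = 0 := by rw [real_inner_comm]; exact hV z hz n' hn'
    have hcv := hn'.inner_nonpos_of_mem_closure (frontier_subset_closure hy)
    rw [← neg_sub, hzy, inner_neg_right, inner_sub_right, inner_smul_right, inner_smul_right]
      at hcv
    have hnn' : 0 ≤ inner ℝ n' n := by
      have h1 : inner ℝ n' n = 1 + inner ℝ (n' - n) n := by
        rw [inner_sub_left, real_inner_self_eq_norm_sq, hn.1]; ring
      have h2 := abs_le.1 (abs_real_inner_le_norm (n' - n) n)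
      rw [hn.1, mul_one] at h2
      linarith [h2.1]
    have hnv' : 0 ≤ inner ℝ n' v := by
      have : 0 ≤ s * inner ℝ n' v := by nlinarith
      exact nonneg_of_mul_nonneg_right this hs
    -- first order expansion of `V` at `y`, tested with the normal at `z`
    have hexp : s * inner ℝ n' (S v) ≤ r * ‖S‖ + δ * (s * (‖v‖ + 1)) := by
      have e : V z - V y - S (z - y) = V z - v - s • S v + r • S n := by
        rw [hzy, map_sub, map_smul, map_smul, ← hv]
        abel
      have h1 := abs_le.1 (abs_real_inner_le_norm n' (V z - V y - S (z - y)))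
      rw [hn'.1, one_mul] at h1
      have h2 := h1.1
      have h4 : ‖V z - V y - S (z - y)‖ ≤ δ * (s * (‖v‖ + 1)) :=
        hlin'.trans (by gcongr)
      rw [e] at h2 h4
      rw [inner_add_right, inner_sub_right, inner_sub_right, hzero, inner_smul_right,
        inner_smul_right] at h2
      have h3 : inner ℝ n' (S n) ≤ ‖S‖ := by
        refine (real_inner_le_norm _ _).trans ?_
        rw [hn'.1, one_mul]
        have := S.le_opNorm n
        rwa [hn.1, mul_one] at this
      nlinarith
    have hSv : inner ℝ n' (S v) ≤ δ * (‖S‖ + ‖v‖ + 1) := by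
      have : s * inner ℝ n' (S v) ≤ s * (δ * (‖S‖ + ‖v‖ + 1)) := by
        have : r * ‖S‖ ≤ δ * s * ‖S‖ := by gcongr
        linarith
      exact le_of_mul_le_mul_left this hs
    have hdif : inner ℝ n (S v) - inner ℝ n' (S v) ≤ δ * ‖S v‖ := by
      rw [← inner_sub_left]
      refine (real_inner_le_norm _ _).trans ?_
      rw [norm_sub_rev]
      gcongr
    rw [hM]
    linarith
  refine le_of_forall_pos_le_add fun ε hε => ?_
  rw [zero_add]
  refine (key (min 1 (ε / M)) (by positivity) (min_le_left _ _)).trans ?_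
  calc min 1 (ε / M) * M ≤ ε / M * M := by gcongr; exact min_le_right _ _
    _ = ε := by field_simp

end

/-! ### Ellipticity and the pointwise Bernstein inequality -/

section

variable {N : ℕ} {Ω : Set (Euc N)}

/-- The flux `F(ξ) = a(|ξ|²) ξ`. -/
noncomputable def flux (a : ℝ → ℝ) (ξ : Euc N) : Euc N := a (‖ξ‖ ^ 2) • ξ

theorem hasFDerivAt_norm_sq_two (ξ : Euc N) :
    HasFDerivAt (fun ξ : Euc N => ‖ξ‖ ^ 2) ((2 : ℝ) • innerSL ℝ ξ) ξ :=
  (hasStrictFDerivAt_norm_sq ξ).hasFDerivAt.congr_fderiv (by ext; simp)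

theorem hasFDerivAt_flux {a : ℝ → ℝ} {ξ : Euc N} (ha : DifferentiableAt ℝ a (‖ξ‖ ^ 2)) :
    HasFDerivAt (flux a) (a (‖ξ‖ ^ 2) • ContinuousLinearMap.id ℝ (Euc N) +
      (deriv a (‖ξ‖ ^ 2) • (2 : ℝ) • innerSL ℝ ξ).smulRight ξ) ξ := by
  have h1 : HasFDerivAt (fun ξ : Euc N => a (‖ξ‖ ^ 2))
      (deriv a (‖ξ‖ ^ 2) • (2 : ℝ) • innerSL ℝ ξ) ξ := by
    exact ha.hasDerivAt.comp_hasFDerivAt ξ (hasFDerivAt_norm_sq_two ξ)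
  exact h1.smul (hasFDerivAt_id ξ)

theorem fderiv_flux_apply {a : ℝ → ℝ} {ξ : Euc N} (ha : DifferentiableAt ℝ a (‖ξ‖ ^ 2))
    (v : Euc N) : fderiv ℝ (flux a) ξ v =
      a (‖ξ‖ ^ 2) • v + (2 * deriv a (‖ξ‖ ^ 2) * inner ℝ ξ v) • ξ := by
  rw [(hasFDerivAt_flux ha).fderiv]
  simp only [add_apply, smul_apply,
    ContinuousLinearMap.smulRight_apply, ContinuousLinearMap.id_apply, innerSL_apply_apply,
    smul_eq_mul]
  congr 2
  ring

/-- Ellipticity, possibly degenerate, of a coefficient `a` of class `C²` on `[0, ∞)`. The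
derivative of the flux at `ξ` has the eigenvalues `a(s)` and, in the radial direction,
`a(s) + 2 s a'(s)`, where `s = |ξ|²`. -/
structure IsElliptic (a : ℝ → ℝ) : Prop where
  contDiffAt : ∀ s, 0 ≤ s → ContDiffAt ℝ 2 a s
  pos : ∀ s, 0 ≤ s → 0 < a s
  add_nonneg : ∀ s, 0 ≤ s → 0 ≤ a s + 2 * s * deriv a s

theorem IsDiffusion.isElliptic {p : ℝ} {α : ℝ → ℝ} (h : IsDiffusion p α) {ε : ℝ} (hε : 0 < ε) :
    IsElliptic (regCoeff α ε) where
  contDiffAt s hs := by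
    have h1 : ContDiffAt ℝ 2 α (s + ε) := h.smooth.contDiffAt (Ioi_mem_nhds (by linarith))
    exact ContDiffAt.comp s h1 (by fun_prop)
  pos s hs := h.pos _ (by linarith)
  add_nonneg s hs := by
    obtain ⟨i, hi, hglb⟩ := h.lower_index
    have hpos := h.pos (s + ε) (by linarith)
    have h1 := hglb.1 (mem_image_of_mem _ (show s + ε ∈ Ioi (0 : ℝ) from by
      rw [mem_Ioi]; linarith))
    have hd : deriv (regCoeff α ε) s = deriv α (s + ε) := deriv_comp_add_const ..
    rw [hd]
    simp only [regCoeff]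
    have h2 : -1 < 2 * (s + ε) * deriv α (s + ε) / α (s + ε) := lt_of_lt_of_le hi h1
    rw [lt_div_iff₀ hpos] at h2
    rcases le_total 0 (deriv α (s + ε)) with h3 | h3
    · positivity
    · nlinarith

variable {a : ℝ → ℝ}

theorem IsElliptic.differentiableAt (ha : IsElliptic a) (ξ : Euc N) :
    DifferentiableAt ℝ a (‖ξ‖ ^ 2) :=
  (ha.contDiffAt _ (sq_nonneg _)).differentiableAt two_ne_zero

theorem IsElliptic.contDiff_flux (ha : IsElliptic a) : ContDiff ℝ 2 (flux a : Euc N → Euc N) := by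
  refine contDiff_iff_contDiffAt.2 fun ξ => ?_
  have h1 : ContDiffAt ℝ 2 (fun ξ : Euc N => a (‖ξ‖ ^ 2)) ξ :=
    ContDiffAt.comp ξ (ha.contDiffAt _ (sq_nonneg _)) (contDiff_norm_sq ℝ).contDiffAt
  exact h1.smul contDiffAt_id

theorem IsElliptic.inner_fderiv_flux_comm (ha : IsElliptic a) (ξ v w : Euc N) :
    inner ℝ v (fderiv ℝ (flux a) ξ w) = inner ℝ (fderiv ℝ (flux a) ξ v) w := by
  rw [fderiv_flux_apply (ha.differentiableAt ξ), fderiv_flux_apply (ha.differentiableAt ξ)]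
  simp only [inner_add_left, inner_add_right, real_inner_smul_left, inner_smul_right]
  rw [real_inner_comm ξ v]
  ring

theorem IsElliptic.inner_fderiv_flux_self_nonneg (ha : IsElliptic a) (ξ v : Euc N) :
    0 ≤ inner ℝ v (fderiv ℝ (flux a) ξ v) := by
  rw [fderiv_flux_apply (ha.differentiableAt ξ), inner_add_right, inner_smul_right,
    inner_smul_right, real_inner_self_eq_norm_sq, real_inner_comm v ξ]
  have h1 := ha.add_nonneg _ (sq_nonneg ‖ξ‖)
  have h2 := ha.pos _ (sq_nonneg ‖ξ‖)
  have h3 : inner ℝ ξ v * inner ℝ ξ v ≤ ‖ξ‖ ^ 2 * ‖v‖ ^ 2 := by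
    have := real_inner_mul_inner_self_le ξ v
    rwa [real_inner_self_eq_norm_sq, real_inner_self_eq_norm_sq] at this
  rw [real_inner_comm ξ v] at *
  set t := inner ℝ ξ v * inner ℝ ξ v with ht
  have ht0 : 0 ≤ t := mul_self_nonneg _
  have e : a (‖ξ‖ ^ 2) * ‖v‖ ^ 2 + 2 * deriv a (‖ξ‖ ^ 2) * inner ℝ ξ v * inner ℝ ξ v =
      a (‖ξ‖ ^ 2) * ‖v‖ ^ 2 + 2 * deriv a (‖ξ‖ ^ 2) * t := by rw [ht]; ring
  rw [e]
  rcases le_total 0 (deriv a (‖ξ‖ ^ 2)) with h | h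
  · positivity
  · nlinarith [sq_nonneg ‖v‖, mul_nonneg h1 (sq_nonneg ‖v‖)]

/-- The trace as a continuous linear functional. -/
noncomputable def traceL (N : ℕ) : (Euc N →L[ℝ] Euc N) →L[ℝ] ℝ :=
  LinearMap.toContinuousLinearMap ((LinearMap.trace ℝ (Euc N)) ∘ₗ ContinuousLinearMap.coeLM ℝ)

theorem divergence_eq_traceL (Y : Euc N → Euc N) (x : Euc N) :
    divergence Y x = traceL N (fderiv ℝ Y x) := rfl

theorem traceL_eq_sum (L : Euc N →L[ℝ] Euc N) : traceL N L =
    ∑ i, inner ℝ (EuclideanSpace.basisFun (Fin N) ℝ i) (L (EuclideanSpace.basisFun (Fin N) ℝ i)) :=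
  LinearMap.trace_eq_sum_inner _ _

theorem traceL_smulRight (f : Euc N →L[ℝ] ℝ) (v : Euc N) : traceL N (f.smulRight v) = f v := by
  rw [traceL_eq_sum]
  conv_rhs => rw [← (EuclideanSpace.basisFun (Fin N) ℝ).sum_repr v, map_sum]
  refine Finset.sum_congr rfl fun i _ => ?_
  rw [ContinuousLinearMap.smulRight_apply, inner_smul_right, map_smul, smul_eq_mul, mul_comm,
    OrthonormalBasis.repr_apply_apply]

/-- `tr (A S S) ≥ 0` for symmetric `S` and nonnegative `A`. -/
theorem traceL_comp_comp_nonneg {A S : Euc N →L[ℝ] Euc N} (hA : ∀ v, 0 ≤ inner ℝ v (A v))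
    (hS : ∀ v w, inner ℝ (S v) w = inner ℝ v (S w)) : 0 ≤ traceL N (A ∘L S ∘L S) := by
  have h : traceL N (A ∘L S ∘L S) = traceL N (S ∘L A ∘L S) :=
    LinearMap.trace_mul_comm ℝ ((A ∘L S : Euc N →L[ℝ] Euc N) : Euc N →ₗ[ℝ] Euc N)
      (S : Euc N →ₗ[ℝ] Euc N)
  rw [h, traceL_eq_sum]
  refine Finset.sum_nonneg fun i _ => ?_
  rw [ContinuousLinearMap.comp_apply, ← hS]
  exact hA _

/-- The field `g(|V|²) DF(V) DV V`. If `V = Du`, it is half the flux that drives the equation for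
`|Du|²`, weighted by `g(|Du|²)`. -/
noncomputable def weightedFlux (a g : ℝ → ℝ) (ξ : Euc N) (S : Euc N →L[ℝ] Euc N) : Euc N :=
  g (‖ξ‖ ^ 2) • fderiv ℝ (flux a) ξ (S ξ)

theorem contDiffOn_weightedFlux (ha : IsElliptic a) {g : ℝ → ℝ}
    (hg : ∀ s, 0 ≤ s → ContDiffAt ℝ 1 g s) (hΩ : IsOpen Ω) {V : Euc N → Euc N}
    (hV : ContDiffOn ℝ 2 V Ω) :
    ContDiffOn ℝ 1 (fun x => weightedFlux a g (V x) (fderiv ℝ V x)) Ω := by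
  have hV1 : ContDiffOn ℝ 1 V Ω := hV.of_le one_le_two
  have h1 : ContDiffOn ℝ 1 (fun x => g (‖V x‖ ^ 2)) Ω := by
    intro x hx
    have h0 : ContDiffWithinAt ℝ 1 (fun x => ‖V x‖ ^ 2) Ω x :=
      ((contDiff_norm_sq ℝ).contDiffAt (x := V x)).comp_contDiffWithinAt x (hV1 x hx)
    exact (hg _ (sq_nonneg _)).comp_contDiffWithinAt x h0
  have h2 : ContDiffOn ℝ 1 (fun x => fderiv ℝ (flux a) (V x)) Ω :=
    (ha.contDiff_flux.fderiv_right (m := 1) (by norm_num)).comp_contDiffOn hV1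
  have h3 : ContDiffOn ℝ 1 (fderiv ℝ V) Ω := hV.fderiv_of_isOpen hΩ (by norm_num)
  exact h1.smul (h2.clm_apply (h3.clm_apply hV1))

/-- The pointwise Bernstein inequality: with `q = div F(V)` and a nondecreasing weight `g`, the
divergence of the weighted flux is at least `g(|V|²) ⟨Dq, V⟩`; the two discarded terms are
`2 g' ⟨DF(V) SV, SV⟩` and `g tr(DF(V) S S)`, with `S = DV` symmetric. -/
theorem le_divergence_weightedFlux (ha : IsElliptic a) {g : ℝ → ℝ}
    (hg : ∀ s, 0 ≤ s → DifferentiableAt ℝ g s) (hg0 : ∀ s, 0 ≤ s → 0 ≤ g s)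
    (hg' : ∀ s, 0 ≤ s → 0 ≤ deriv g s) {V : Euc N → Euc N} {x : Euc N} (hV : ContDiffAt ℝ 2 V x)
    (hS : ∀ v w, inner ℝ (fderiv ℝ V x v) w = inner ℝ v (fderiv ℝ V x w)) :
    g (‖V x‖ ^ 2) * fderiv ℝ (divergence (fun z => flux a (V z))) x (V x) ≤
      divergence (fun z => weightedFlux a g (V z) (fderiv ℝ V z)) x := by
  set Z : Euc N → Euc N := fun z => flux a (V z) with hZdef
  have hZ : ContDiffAt ℝ 2 Z x := ha.contDiff_flux.contDiffAt.comp x hV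
  have hVx : HasFDerivAt V (fderiv ℝ V x) x := (hV.differentiableAt two_ne_zero).hasFDerivAt
  have hZfd : ∀ z, DifferentiableAt ℝ V z →
      fderiv ℝ Z z = fderiv ℝ (flux a) (V z) ∘L fderiv ℝ V z := fun z hz =>
    fderiv_comp z (ha.contDiff_flux.differentiable two_ne_zero _) hz
  have hDZ : HasFDerivAt (fderiv ℝ Z) (fderiv ℝ (fderiv ℝ Z) x) x :=
    ((hZ.fderiv_right (m := 1) (by norm_num)).differentiableAt one_ne_zero).hasFDerivAt
  have hq : fderiv ℝ (divergence Z) x (V x) = traceL N (fderiv ℝ (fderiv ℝ Z) x (V x)) := by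
    have : HasFDerivAt (divergence Z) (traceL N ∘L fderiv ℝ (fderiv ℝ Z) x) x :=
      (traceL N).hasFDerivAt.comp x hDZ
    rw [this.fderiv]
    rfl
  have hφ : HasFDerivAt (fun z => g (‖V z‖ ^ 2))
      (deriv g (‖V x‖ ^ 2) • (2 : ℝ) • (innerSL ℝ (V x) ∘L fderiv ℝ V x)) x := by
    exact (hg _ (sq_nonneg _)).hasDerivAt.comp_hasFDerivAt x
      ((hasFDerivAt_norm_sq_two (V x)).comp x hVx)
  have hX : HasFDerivAt (fun z => fderiv ℝ Z z (V z))
      ((fderiv ℝ Z x) ∘L (fderiv ℝ V x) + (fderiv ℝ (fderiv ℝ Z) x).flip (V x)) x :=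
    hDZ.clm_apply hVx
  have hY : HasFDerivAt (fun z => g (‖V z‖ ^ 2) • fderiv ℝ Z z (V z)) _ x := hφ.smul hX
  have heq : (fun z => weightedFlux a g (V z) (fderiv ℝ V z)) =ᶠ[𝓝 x]
      fun z => g (‖V z‖ ^ 2) • fderiv ℝ Z z (V z) := by
    filter_upwards [hV.eventually (by simp)] with z hz
    rw [hZfd z (hz.differentiableAt two_ne_zero)]
    rfl
  have hsymm : (fderiv ℝ (fderiv ℝ Z) x).flip (V x) = fderiv ℝ (fderiv ℝ Z) x (V x) := by
    ext1 w
    exact (hZ.isSymmSndFDerivAt (by simp)).eq w (V x)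
  rw [divergence_eq_traceL, heq.fderiv_eq, hY.fderiv, hq, map_add, map_smul, map_add,
    traceL_smulRight, hsymm, hZfd x hVx.differentiableAt]
  have h1 : 0 ≤ traceL N (fderiv ℝ (flux a) (V x) ∘L fderiv ℝ V x ∘L fderiv ℝ V x) :=
    traceL_comp_comp_nonneg (ha.inner_fderiv_flux_self_nonneg _) hS
  have h2 := ha.inner_fderiv_flux_self_nonneg (V x) (fderiv ℝ V x (V x))
  have h3 : inner ℝ (V x) (fderiv ℝ V x (fderiv ℝ (flux a) (V x) (fderiv ℝ V x (V x)))) =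
      inner ℝ (fderiv ℝ V x (V x)) (fderiv ℝ (flux a) (V x) (fderiv ℝ V x (V x))) :=
    (hS _ _).symm
  have h4 := hg0 _ (sq_nonneg ‖V x‖)
  have h5 := hg' _ (sq_nonneg ‖V x‖)
  simp only [smul_apply, ContinuousLinearMap.comp_apply, innerSL_apply_apply,
    smul_eq_mul, h3]
  rw [ContinuousLinearMap.comp_assoc]
  have h6 := mul_nonneg h4 h1
  have h7 := mul_nonneg h5 h2
  linarith

/-- A normal `n` to `ξ` is an eigenvector of the symmetric map `DF(ξ)` with the eigenvalue
`a(|ξ|²) > 0`, so that the normal component of the weighted flux has the sign of `⟨n, Sξ⟩`. -/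
theorem inner_weightedFlux_nonpos (ha : IsElliptic a) {g : ℝ → ℝ} (hg0 : ∀ s, 0 ≤ s → 0 ≤ g s)
    {ξ n : Euc N} {S : Euc N →L[ℝ] Euc N} (hξ : inner ℝ ξ n = 0) (hS : inner ℝ n (S ξ) ≤ 0) :
    inner ℝ n (weightedFlux a g ξ S) ≤ 0 := by
  rw [weightedFlux, inner_smul_right, ha.inner_fderiv_flux_comm,
    fderiv_flux_apply (ha.differentiableAt ξ), hξ, mul_zero, zero_smul, add_zero,
    real_inner_smul_left]
  exact mul_nonpos_of_nonneg_of_nonpos (hg0 _ (sq_nonneg _))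
    (mul_nonpos_of_nonneg_of_nonpos (ha.pos _ (sq_nonneg _)).le hS)

/-- The Riesz isomorphism of the dual with the space, as a continuous linear map over `ℝ`. -/
noncomputable def riesz (N : ℕ) : StrongDual ℝ (Euc N) →L[ℝ] Euc N where
  toFun := (InnerProductSpace.toDual ℝ (Euc N)).symm
  map_add' := map_add _
  map_smul' c f := by simp
  cont := (InnerProductSpace.toDual ℝ (Euc N)).symm.continuous

theorem inner_riesz (f : StrongDual ℝ (Euc N)) (v : Euc N) : inner ℝ (riesz N f) v = f v :=
  InnerProductSpace.toDual_symm_apply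

theorem hasFDerivAt_gradient {v : Euc N → ℝ} {x : Euc N} (hv : ContDiffAt ℝ 2 v x) :
    HasFDerivAt (gradient v) (riesz N ∘L fderiv ℝ (fderiv ℝ v) x) x := by
  have h := ((hv.fderiv_right (m := 1) (by norm_num)).differentiableAt one_ne_zero).hasFDerivAt
  exact (riesz N).hasFDerivAt.comp x h

theorem inner_fderiv_gradient {v : Euc N → ℝ} {x : Euc N} (hv : ContDiffAt ℝ 2 v x) (b c : Euc N) :
    inner ℝ (fderiv ℝ (gradient v) x b) c = fderiv ℝ (fderiv ℝ v) x b c := by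
  rw [(hasFDerivAt_gradient hv).fderiv]
  exact inner_riesz _ _

theorem inner_fderiv_gradient_comm {v : Euc N → ℝ} {x : Euc N} (hv : ContDiffAt ℝ 2 v x)
    (b c : Euc N) : inner ℝ (fderiv ℝ (gradient v) x b) c =
      inner ℝ b (fderiv ℝ (gradient v) x c) := by
  rw [real_inner_comm (fderiv ℝ (gradient v) x c) b, inner_fderiv_gradient hv,
    inner_fderiv_gradient hv]
  exact (hv.isSymmSndFDerivAt (by simp)).eq b c

theorem regCoeff_mul_opA_eq_divergence {α : ℝ → ℝ} {ε : ℝ} (ha : IsElliptic (regCoeff α ε))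
    {v : Euc N → ℝ} {x : Euc N} (hv : ContDiffAt ℝ 2 v x) :
    regCoeff α ε (‖gradient v x‖ ^ 2) * opA α ε v x =
      divergence (fun z => flux (regCoeff α ε) (gradient v z)) x := by
  set V := gradient v with hV
  have hVd : DifferentiableAt ℝ V x := (hasFDerivAt_gradient hv).differentiableAt
  have hpos := (ha.pos _ (sq_nonneg ‖V x‖)).ne'
  have hcomp : fderiv ℝ (fun z => flux (regCoeff α ε) (V z)) x =
      regCoeff α ε (‖V x‖ ^ 2) • fderiv ℝ V x +
        ((2 * deriv (regCoeff α ε) (‖V x‖ ^ 2)) • (innerSL ℝ (V x) ∘L fderiv ℝ V x)).smulRight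
          (V x) := by
    rw [show (fun z => flux (regCoeff α ε) (V z)) = flux (regCoeff α ε) ∘ V from rfl,
      fderiv_comp x (ha.contDiff_flux.differentiable two_ne_zero _) hVd]
    ext1 w
    rw [ContinuousLinearMap.comp_apply, fderiv_flux_apply (ha.differentiableAt _)]
    simp [mul_assoc]
  rw [divergence_eq_traceL, hcomp, map_add, map_smul, traceL_smulRight, traceL_eq_sum, opA,
    InnerProductSpace.laplacian_eq_iteratedFDeriv_orthonormalBasis v
      (EuclideanSpace.basisFun (Fin N) ℝ)]
  simp only [iteratedFDeriv_two_apply, Matrix.cons_val_zero, Matrix.cons_val_one,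
    ← inner_fderiv_gradient hv, smul_apply, ContinuousLinearMap.comp_apply,
    innerSL_apply_apply, smul_eq_mul, ← hV]
  rw [mul_add, real_inner_comm (V x) (fderiv ℝ V x (V x))]
  simp only [fun i => real_inner_comm (EuclideanSpace.basisFun (Fin N) ℝ i)
    (fderiv ℝ V x (EuclideanSpace.basisFun (Fin N) ℝ i))]
  field_simp

end

/-! ### Regularity of solutions and dissipation by the diffusion term -/

section

variable {N : ℕ} {Ω : Set (Euc N)} {T : ℝ} {u : ℝ → Euc N → ℝ}

theorem uniqueDiffOn_closure (hΩ : IsOpen Ω) (hc : Convex ℝ Ω) (hne : Ω.Nonempty) :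
    UniqueDiffOn ℝ (closure Ω) :=
  uniqueDiffOn_convex hc.closure
    (hne.mono (interior_maximal subset_closure hΩ))

theorem closure_mem_nhds (hΩ : IsOpen Ω) {x : Euc N} (hx : x ∈ Ω) : closure Ω ∈ 𝓝 x :=
  mem_of_superset (hΩ.mem_nhds hx) subset_closure

theorem gradientWithin_closure_eq (hΩ : IsOpen Ω) {x : Euc N} (hx : x ∈ Ω) (v : Euc N → ℝ) :
    gradientWithin v (closure Ω) x = gradient v x := by
  rw [gradientWithin, gradient, fderivWithin_of_mem_nhds (closure_mem_nhds hΩ hx)]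

theorem fderivWithin_gradientWithin_closure_eq (hΩ : IsOpen Ω) {x : Euc N} (hx : x ∈ Ω)
    (v : Euc N → ℝ) :
    fderivWithin ℝ (gradientWithin v (closure Ω)) (closure Ω) x = fderiv ℝ (gradient v) x := by
  rw [fderivWithin_of_mem_nhds (closure_mem_nhds hΩ hx)]
  refine Filter.EventuallyEq.fderiv_eq ?_
  filter_upwards [hΩ.mem_nhds hx] with z hz
  exact gradientWithin_closure_eq hΩ hz v

theorem contDiffOn_gradientWithin_closure (hΩ : IsOpen Ω) (hc : Convex ℝ Ω) (hne : Ω.Nonempty)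
    {v : Euc N → ℝ} (hv : ContDiffOn ℝ 2 v (closure Ω)) :
    ContDiffOn ℝ 1 (gradientWithin v (closure Ω)) (closure Ω) :=
  (riesz N).contDiff.comp_contDiffOn
    (hv.fderivWithin (uniqueDiffOn_closure hΩ hc hne) (by norm_num))

theorem contDiffOn_gradient (hΩ : IsOpen Ω) {n : ℕ∞ω} {v : Euc N → ℝ}
    (hv : ContDiffOn ℝ (n + 1) v Ω) : ContDiffOn ℝ n (gradient v) Ω :=
  (riesz N).contDiff.comp_contDiffOn (hv.fderiv_of_isOpen hΩ le_rfl)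

namespace IsParabolicSmooth

theorem continuousOn_gradientWithin (hu : IsParabolicSmooth Ω T u) (hΩ : IsOpen Ω)
    (hc : Convex ℝ Ω) (hne : Ω.Nonempty) :
    ContinuousOn (fun z : ℝ × Euc N => gradientWithin (u z.1) (closure Ω) z.2)
      (Ioo 0 T ×ˢ closure Ω) := by
  have hud := uniqueDiffOn_closure hΩ hc hne
  refine (riesz N).continuous.comp_continuousOn ?_
  refine continuousOn_clm_apply.2 fun e => ?_
  have h1 := hu.continuousOn_closure 1 one_le_two
  have h2 : ContinuousOn (fun z : ℝ × Euc N =>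
      iteratedFDerivWithin ℝ 1 (u z.1) (closure Ω) z.2 ![e]) (Ioo 0 T ×ˢ closure Ω) :=
    (ContinuousMultilinearMap.apply ℝ (fun _ : Fin 1 => Euc N) ℝ ![e]).continuous.comp_continuousOn
      h1
  refine h2.congr fun z hz => ?_
  beta_reduce
  rw [iteratedFDerivWithin_one_apply (hud _ hz.2)]
  rfl

theorem continuousOn_fderivWithin_gradientWithin (hu : IsParabolicSmooth Ω T u) (hΩ : IsOpen Ω)
    (hc : Convex ℝ Ω) (hne : Ω.Nonempty) :
    ContinuousOn (fun z : ℝ × Euc N =>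
      fderivWithin ℝ (gradientWithin (u z.1) (closure Ω)) (closure Ω) z.2)
      (Ioo 0 T ×ˢ closure Ω) := by
  have hud := uniqueDiffOn_closure hΩ hc hne
  have hD : ContinuousOn (fun z : ℝ × Euc N =>
      fderivWithin ℝ (fderivWithin ℝ (u z.1) (closure Ω)) (closure Ω) z.2)
      (Ioo 0 T ×ˢ closure Ω) := by
    refine continuousOn_clm_apply.2 fun e => continuousOn_clm_apply.2 fun e' => ?_
    have h2 : ContinuousOn (fun z : ℝ × Euc N =>
        iteratedFDerivWithin ℝ 2 (u z.1) (closure Ω) z.2 ![e, e']) (Ioo 0 T ×ˢ closure Ω) :=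
      (ContinuousMultilinearMap.apply ℝ (fun _ : Fin 2 => Euc N) ℝ
        ![e, e']).continuous.comp_continuousOn (hu.continuousOn_closure 2 le_rfl)
    refine h2.congr fun z hz => ?_
    beta_reduce
    rw [iteratedFDerivWithin_two_apply _ hud hz.2]
    rfl
  have h3 : ContinuousOn (fun z : ℝ × Euc N => (riesz N) ∘L
      fderivWithin ℝ (fderivWithin ℝ (u z.1) (closure Ω)) (closure Ω) z.2)
      (Ioo 0 T ×ˢ closure Ω) := continuousOn_const.clm_comp hD
  refine h3.congr fun z hz => ?_
  have hd : DifferentiableWithinAt ℝ (fderivWithin ℝ (u z.1) (closure Ω)) (closure Ω) z.2 :=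
    ((hu.contDiffOn_closure _ hz.1).fderivWithin hud (m := 1) (by norm_num)).differentiableOn
      one_ne_zero _ hz.2
  exact ((riesz N).hasFDerivAt.comp_hasFDerivWithinAt z.2 hd.hasFDerivWithinAt).fderivWithin
    (hud _ hz.2)

theorem continuousOn_gradient (hu : IsParabolicSmooth Ω T u) (hΩ : IsOpen Ω)
    (hc : Convex ℝ Ω) (hne : Ω.Nonempty) :
    ContinuousOn (fun z : ℝ × Euc N => gradient (u z.1) z.2) (Ioo 0 T ×ˢ Ω) :=
  ((hu.continuousOn_gradientWithin hΩ hc hne).mono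
    (prod_mono subset_rfl subset_closure)).congr fun _ hz =>
      (gradientWithin_closure_eq hΩ hz.2 _).symm

/-- The time derivative of the space gradient is the space gradient of the time derivative: the
identity `u(t) = u(a) + ∫ₐᵗ ∂ₜu` is differentiated in space under the integral sign. -/
theorem hasDerivAt_gradient (hu : IsParabolicSmooth Ω T u) (hΩ : IsOpen Ω) {t : ℝ}
    (ht : t ∈ Ioo 0 T) {x : Euc N} (hx : x ∈ Ω) :
    HasDerivAt (fun s => gradient (u s) x)
      (gradient (fun y => deriv (fun s => u s y) t) x) t := by
  set ut : ℝ → Euc N → ℝ := fun σ y => deriv (fun s => u s y) σ with hut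
  obtain ⟨a, ha0, hat⟩ := exists_between ht.1
  have haT : a ∈ Ioo 0 T := ⟨ha0, hat.trans ht.2⟩
  have hsub : ∀ τ ∈ Ioo 0 T, uIcc a τ ⊆ Ioo 0 T := fun τ hτ =>
    ordConnected_Ioo.uIcc_subset haT hτ
  have hcut : ∀ y ∈ Ω, ContinuousOn (fun σ => ut σ y) (Ioo 0 T) := fun y hy =>
    hu.continuousOn_time.comp (f := fun σ => (σ, y)) (by fun_prop) fun σ hσ => ⟨hσ, hy⟩
  have hcgr : ∀ y ∈ Ω, ContinuousOn (fun σ => gradient (ut σ) y) (Ioo 0 T) := fun y hy =>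
    hu.continuousOn_time_gradient.comp (f := fun σ => (σ, y)) (by fun_prop) fun σ hσ => ⟨hσ, hy⟩
  have hcfd : ContinuousOn (fun σ => fderiv ℝ (ut σ) x) (Ioo 0 T) := by
    have h := (InnerProductSpace.toDual ℝ (Euc N)).continuous.comp_continuousOn (hcgr x hx)
    refine h.congr fun σ _ => ?_
    exact toDual_gradient.symm
  have hrep : ∀ τ ∈ Ioo 0 T, ∀ y ∈ Ω, u τ y = u a y + ∫ σ in a..τ, ut σ y := by
    intro τ hτ y hy
    rw [intervalIntegral.integral_eq_sub_of_hasDerivAt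
      (f := fun s => u s y)
      (fun σ hσ => (hu.differentiableAt_time σ (hsub τ hτ hσ) y hy).hasDerivAt)
      (((hcut y hy).mono (hsub τ hτ)).intervalIntegrable)]
    ring
  obtain ⟨r, hr, hrΩ⟩ := Metric.nhds_basis_closedBall.mem_iff.1 (hΩ.mem_nhds hx)
  have hfd : ∀ τ ∈ Ioo 0 T,
      fderiv ℝ (u τ) x = fderiv ℝ (u a) x + ∫ σ in a..τ, fderiv ℝ (ut σ) x := by
    intro τ hτ
    have hcpt : IsCompact (uIcc a τ ×ˢ Metric.closedBall x r) :=
      isCompact_uIcc.prod (isCompact_closedBall x r)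
    obtain ⟨C, hC⟩ := hcpt.exists_bound_of_continuousOn
      (hu.continuousOn_time_gradient.mono (prod_mono (hsub τ hτ) hrΩ))
    have hint : HasFDerivAt (fun y => ∫ σ in a..τ, ut σ y) (∫ σ in a..τ, fderiv ℝ (ut σ) x) x := by
      refine intervalIntegral.hasFDerivAt_integral_of_dominated_of_fderiv_le
        (F := fun y σ => ut σ y) (F' := fun y σ => fderiv ℝ (ut σ) y) (bound := fun _ => C)
        (Metric.closedBall_mem_nhds x hr) ?_ ?_ ?_ ?_ ?_ ?_
      · filter_upwards [hΩ.mem_nhds hx] with y hy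
        exact (((hcut y hy).mono ((uIoc_subset_uIcc).trans (hsub τ hτ))).aestronglyMeasurable
          measurableSet_uIoc)
      · exact ((hcut x hx).mono (hsub τ hτ)).intervalIntegrable
      · exact ((hcfd.mono ((uIoc_subset_uIcc).trans (hsub τ hτ))).aestronglyMeasurable
          measurableSet_uIoc)
      · refine ae_of_all _ fun σ hσ y hy => ?_
        have := hC (σ, y) ⟨uIoc_subset_uIcc hσ, hy⟩
        rwa [← toDual_gradient, LinearIsometryEquiv.norm_map]
      · exact intervalIntegrable_const
      · refine ae_of_all _ fun σ hσ y hy => ?_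
        exact (((hu.contDiffOn_time σ (hsub τ hτ (uIoc_subset_uIcc hσ))).contDiffAt
          (hΩ.mem_nhds (hrΩ hy))).differentiableAt one_ne_zero).hasFDerivAt
    have hua : HasFDerivAt (u a) (fderiv ℝ (u a) x) x :=
      (((hu.contDiffOn_interior a haT).contDiffAt (hΩ.mem_nhds hx)).differentiableAt
        (by norm_num)).hasFDerivAt
    have heq : u τ =ᶠ[𝓝 x] fun y => u a y + ∫ σ in a..τ, ut σ y := by
      filter_upwards [hΩ.mem_nhds hx] with y hy
      exact hrep τ hτ y hy
    rw [heq.fderiv_eq]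
    exact (hua.add hint).fderiv
  have hcont : ContinuousAt (fun σ => fderiv ℝ (ut σ) x) t :=
    hcfd.continuousAt (isOpen_Ioo.mem_nhds ht)
  have hder : HasDerivAt (fun τ => fderiv ℝ (u a) x + ∫ σ in a..τ, fderiv ℝ (ut σ) x)
      (fderiv ℝ (ut t) x) t :=
    (intervalIntegral.integral_hasDerivAt_right
      ((hcfd.mono (hsub t ht)).intervalIntegrable)
      (hcfd.stronglyMeasurableAtFilter isOpen_Ioo t ht) hcont).const_add _
  have hder' : HasDerivAt (fun τ => fderiv ℝ (u τ) x) (fderiv ℝ (ut t) x) t := by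
    refine hder.congr_of_eventuallyEq ?_
    filter_upwards [isOpen_Ioo.mem_nhds ht] with τ hτ
    exact hfd τ hτ
  exact (riesz N).hasFDerivAt.comp_hasDerivAt t hder'

end IsParabolicSmooth

/-- The weighted flux of `Du` has a normal component that is uniformly small near the lateral
boundary, on compact time intervals. -/
theorem IsSolution.exists_inner_weightedFlux_le {α : ℝ → ℝ} {ε : ℝ} {f : ℝ → Euc N → ℝ}
    {u₀ : Euc N → ℝ} {Du₀ : Euc N → Euc N} (hΩ : IsOpen Ω) (hc : Convex ℝ Ω) (hne : Ω.Nonempty)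
    (hb : Bornology.IsBounded Ω) (hC1 : HasC1Boundary Ω) (hu : IsSolution Ω T α ε f u₀ Du₀ u)
    (ha : IsElliptic (regCoeff α ε)) {g : ℝ → ℝ} (hg : ∀ s, 0 ≤ s → ContinuousAt g s)
    (hg0 : ∀ s, 0 ≤ s → 0 ≤ g s) {s t : ℝ} (hs : 0 < s) (ht : t < T) {β : ℝ} (hβ : 0 < β) :
    ∃ δ₁ > 0, ∀ τ ∈ Icc s t, ∀ x ∈ Ω, ∀ y ∈ frontier Ω, ∀ n, IsOutwardNormal Ω y n →
      ‖y - x‖ ≤ δ₁ → inner ℝ n (weightedFlux (regCoeff α ε) g (gradient (u τ) x)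
        (fderiv ℝ (gradient (u τ)) x)) ≤ β := by
  set Y : ℝ × Euc N → Euc N := fun z => weightedFlux (regCoeff α ε) g
    (gradientWithin (u z.1) (closure Ω) z.2)
    (fderivWithin ℝ (gradientWithin (u z.1) (closure Ω)) (closure Ω) z.2) with hY
  have hIcc : Icc s t ⊆ Ioo 0 T := fun τ hτ => ⟨hs.trans_le hτ.1, hτ.2.trans_lt ht⟩
  have hYc : ContinuousOn Y (Ioo 0 T ×ˢ closure Ω) := by
    have hV := hu.smooth.continuousOn_gradientWithin hΩ hc hne
    have hS := hu.smooth.continuousOn_fderivWithin_gradientWithin hΩ hc hne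
    have h1 : ContinuousOn (fun z : ℝ × Euc N =>
        g (‖gradientWithin (u z.1) (closure Ω) z.2‖ ^ 2)) (Ioo 0 T ×ˢ closure Ω) := fun z hz =>
      (hg _ (sq_nonneg _)).comp_continuousWithinAt
        (f := fun z : ℝ × Euc N => ‖gradientWithin (u z.1) (closure Ω) z.2‖ ^ 2)
        ((hV z hz).norm.pow 2)
    have h2 : Continuous (fderiv ℝ (flux (regCoeff α ε) : Euc N → Euc N)) :=
      ha.contDiff_flux.continuous_fderiv two_ne_zero
    exact h1.smul ((h2.comp_continuousOn hV).clm_apply (hS.clm_apply hV))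
  have hcpt : IsCompact (Icc s t ×ˢ closure Ω) :=
    isCompact_Icc.prod hb.isCompact_closure
  have huc := hcpt.uniformContinuousOn_of_continuous
    (hYc.mono (prod_mono hIcc subset_rfl))
  obtain ⟨δ₁, hδ₁, hδ⟩ := Metric.uniformContinuousOn_iff_le.1 huc β hβ
  refine ⟨δ₁, hδ₁, fun τ hτ x hx y hy n hn hxy => ?_⟩
  have hbd : inner ℝ n (Y (τ, y)) ≤ 0 := by
    refine inner_weightedFlux_nonpos ha hg0
      (hu.neumann τ (hIcc hτ) y hy n hn) ?_
    refine inner_fderivWithin_self_nonpos hΩ hc hne hC1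
      (fun z hz n hn => hu.neumann τ (hIcc hτ) z hz n hn) hy hn ?_
    exact (contDiffOn_gradientWithin_closure hΩ hc hne
      (hu.smooth.contDiffOn_closure τ (hIcc hτ))).differentiableOn one_ne_zero y
      (frontier_subset_closure hy)
  have hdist := hδ (τ, x) ⟨hτ, subset_closure hx⟩ (τ, y) ⟨hτ, frontier_subset_closure hy⟩ (by
    rw [Prod.dist_eq, dist_self, dist_eq_norm, norm_sub_rev]
    exact max_le hδ₁.le hxy)
  have hYx : Y (τ, x) = weightedFlux (regCoeff α ε) g (gradient (u τ) x)
      (fderiv ℝ (gradient (u τ)) x) := by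
    simp only [hY]
    rw [gradientWithin_closure_eq hΩ hx, fderivWithin_gradientWithin_closure_eq hΩ hx]
  rw [← hYx]
  have h1 : inner ℝ n (Y (τ, x)) = inner ℝ n (Y (τ, y)) + inner ℝ n (Y (τ, x) - Y (τ, y)) := by
    rw [inner_sub_right]; ring
  have h2 := real_inner_le_norm n (Y (τ, x) - Y (τ, y))
  rw [hn.1, one_mul, ← dist_eq_norm] at h2
  linarith

theorem integrableOn_cutoff_mul (hΩ : IsOpen Ω) (hb : Bornology.IsBounded Ω) {δ : ℝ}
    (hδ : 0 < δ) {h : Euc N → ℝ}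
    (hh : ContinuousOn h Ω) : IntegrableOn (fun x => cutoff Ω δ x * h x) Ω := by
  have hK := hasCompactSupport_cutoff hb hδ
  have h1 : IntegrableOn (fun x => cutoff Ω δ x * h x) (tsupport (cutoff Ω δ)) :=
    (((lipschitzWith_cutoff Ω hδ).continuous.continuousOn).mul
      (hh.mono (tsupport_cutoff_subset_self hδ))).integrableOn_compact hK
  refine h1.of_forall_sdiff_eq_zero hΩ.measurableSet fun x hx => ?_
  rw [image_eq_zero_of_notMem_tsupport hx.2, zero_mul]

/-- The diffusion term dissipates, up to an arbitrarily small error, every convex nondecreasing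
function of `|Du|²`, when tested with the cutoff. -/
theorem IsSolution.exists_setIntegral_cutoff_le {α : ℝ → ℝ} {ε : ℝ} {f : ℝ → Euc N → ℝ}
    {u₀ : Euc N → ℝ} {Du₀ : Euc N → Euc N} (hΩ : IsOpen Ω) (hc : Convex ℝ Ω) (hne : Ω.Nonempty)
    (hne' : Ωᶜ.Nonempty) (hvol : volume Ω < ⊤) (hC1 : HasC1Boundary Ω)
    (hu : IsSolution Ω T α ε f u₀ Du₀ u) (ha : IsElliptic (regCoeff α ε)) {g : ℝ → ℝ}
    (hg : ∀ s, 0 ≤ s → ContDiffAt ℝ 1 g s) (hg0 : ∀ s, 0 ≤ s → 0 ≤ g s)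
    (hg' : ∀ s, 0 ≤ s → 0 ≤ deriv g s) {s t : ℝ} (hs : 0 < s) (ht : t < T) {β : ℝ} (hβ : 0 < β) :
    ∃ δ₁ > 0, ∀ δ, 0 < δ → δ ≤ δ₁ → ∀ τ ∈ Icc s t,
      ∫ x in Ω, cutoff Ω δ x * (g (‖gradient (u τ) x‖ ^ 2) *
        fderiv ℝ (divergence fun z => flux (regCoeff α ε) (gradient (u τ) z)) x
          (gradient (u τ) x)) ≤ β := by
  have hb := isBounded_of_volume_lt_top hΩ hc hne hvol
  obtain ⟨K, hK, δ₀, hδ₀, hflux⟩ :=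
    exists_setIntegral_cutoff_mul_divergence_le hΩ hc hne hne' hvol
  have hβ' : 0 < β / (K + 1) := by positivity
  obtain ⟨δ₁, hδ₁, hδ⟩ := hu.exists_inner_weightedFlux_le hΩ hc hne hb hC1 ha
    (fun s hs => (hg s hs).continuousAt) hg0 hs ht hβ'
  refine ⟨min δ₀ (δ₁ / 2), by positivity, fun δ hδ0 hδ' τ hτ => ?_⟩
  have hτ' : τ ∈ Ioo 0 T := ⟨hs.trans_le hτ.1, hτ.2.trans_lt ht⟩
  have hu3 := hu.smooth.contDiffOn_interior τ hτ'
  have hV : ContDiffOn ℝ 2 (gradient (u τ)) Ω :=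
    contDiffOn_gradient hΩ (by norm_num; exact hu3)
  have hY := contDiffOn_weightedFlux ha hg hΩ hV
  have hdiv : ContDiffOn ℝ 1 (divergence fun z => flux (regCoeff α ε) (gradient (u τ) z)) Ω :=
    (traceL N).contDiff.comp_contDiffOn
      ((ha.contDiff_flux.comp_contDiffOn hV).fderiv_of_isOpen hΩ (by norm_num))
  calc _ ≤ ∫ x in Ω, cutoff Ω δ x * divergence (fun z => weightedFlux (regCoeff α ε) g
          (gradient (u τ) z) (fderiv ℝ (gradient (u τ)) z)) x := by
        refine setIntegral_mono_on (integrableOn_cutoff_mul hΩ hb hδ0 ?_)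
          (integrableOn_cutoff_mul hΩ hb hδ0 (continuousOn_divergence hΩ hY)) hΩ.measurableSet ?_
        · have h1 : ContinuousOn (fun x => g (‖gradient (u τ) x‖ ^ 2)) Ω := fun x hx =>
            (hg _ (sq_nonneg _)).continuousAt.comp_continuousWithinAt
              (f := fun x => ‖gradient (u τ) x‖ ^ 2) ((hV.continuousOn x hx).norm.pow 2)
          exact h1.mul ((hdiv.continuousOn_fderiv_of_isOpen hΩ le_rfl).clm_apply hV.continuousOn)
        · intro x hx
          refine mul_le_mul_of_nonneg_left ?_ (cutoff_nonneg _ _ _)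
          have hux : ContDiffAt ℝ 2 (u τ) x :=
            (hu3.contDiffAt (hΩ.mem_nhds hx)).of_le (by norm_num)
          exact le_divergence_weightedFlux ha
            (fun s hs => (hg s hs).differentiableAt one_ne_zero) hg0 hg'
            (hV.contDiffAt (hΩ.mem_nhds hx)) (inner_fderiv_gradient_comm hux)
    _ ≤ K * (β / (K + 1)) := by
        refine hflux δ hδ0 (hδ'.trans (min_le_left _ _)) _ hβ'.le _ hY ?_
        intro x hx y hy n hn hxy
        refine hδ τ hτ x hx y hy n hn (hxy.trans ?_)
        have := hδ'.trans (min_le_right _ _)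
        linarith
    _ ≤ β := by
        rw [mul_div_assoc', div_le_iff₀ (by positivity)]
        nlinarith

/-- In the interior, the gradient of the diffusion term is `D∂ₜu - Df`. -/
theorem IsSolution.fderiv_divergence_flux_eq {α : ℝ → ℝ} {ε : ℝ} {f : ℝ → Euc N → ℝ}
    {u₀ : Euc N → ℝ} {Du₀ : Euc N → Euc N} (hΩ : IsOpen Ω)
    (hu : IsSolution Ω T α ε f u₀ Du₀ u) (ha : IsElliptic (regCoeff α ε))
    {t : ℝ} (ht : t ∈ Ioo 0 T) (hf : ContDiffOn ℝ 1 (f t) Ω) {x : Euc N} (hx : x ∈ Ω)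
    (v : Euc N) :
    fderiv ℝ (divergence fun z => flux (regCoeff α ε) (gradient (u t) z)) x v =
      inner ℝ (gradient (fun y => deriv (fun s => u s y) t) x - gradient (f t) x) v := by
  have heq : (divergence fun z => flux (regCoeff α ε) (gradient (u t) z)) =ᶠ[𝓝 x]
      fun y => deriv (fun s => u s y) t - f t y := by
    filter_upwards [hΩ.mem_nhds hx] with y hy
    have huy : ContDiffAt ℝ 2 (u t) y :=
      ((hu.smooth.contDiffOn_interior t ht).contDiffAt (hΩ.mem_nhds hy)).of_le (by norm_num)
    rw [← regCoeff_mul_opA_eq_divergence ha huy, ← hu.equation t ht y hy]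
    ring
  have h1 := ((hu.smooth.contDiffOn_time t ht).contDiffAt (hΩ.mem_nhds hx)).differentiableAt
    one_ne_zero
  have h2 := (hf.contDiffAt (hΩ.mem_nhds hx)).differentiableAt one_ne_zero
  rw [heq.fderiv_eq, inner_sub_left, inner_gradient_left, inner_gradient_left,
    fderiv_fun_sub h1 h2]
  rfl

end

/-! ### The energy inequality between positive times -/

section

variable {N : ℕ} {Ω : Set (Euc N)} {T : ℝ} {u : ℝ → Euc N → ℝ} {f : ℝ → Euc N → ℝ}

theorem contDiffOn_slice (hf : ContDiffOn ℝ 1 (fun z : ℝ × Euc N => f z.1 z.2) (Ioo 0 T ×ˢ Ω))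
    {t : ℝ} (ht : t ∈ Ioo 0 T) : ContDiffOn ℝ 1 (f t) Ω :=
  hf.comp (f := fun x => (t, x)) (by fun_prop) fun _ hx => ⟨ht, hx⟩

theorem continuousOn_gradient_slice (hΩ : IsOpen Ω)
    (hf : ContDiffOn ℝ 1 (fun z : ℝ × Euc N => f z.1 z.2) (Ioo 0 T ×ˢ Ω)) :
    ContinuousOn (fun z : ℝ × Euc N => gradient (f z.1) z.2) (Ioo 0 T ×ˢ Ω) := by
  have hQ : IsOpen (Ioo 0 T ×ˢ Ω) := isOpen_Ioo.prod hΩ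
  have h1 : ContinuousOn (fun z : ℝ × Euc N =>
      (fderiv ℝ (fun z : ℝ × Euc N => f z.1 z.2) z) ∘L ContinuousLinearMap.inr ℝ ℝ (Euc N))
      (Ioo 0 T ×ˢ Ω) :=
    (hf.continuousOn_fderiv_of_isOpen hQ le_rfl).clm_comp continuousOn_const
  refine (riesz N).continuous.comp_continuousOn (h1.congr fun z hz => ?_)
  have hd : DifferentiableAt ℝ (fun z : ℝ × Euc N => f z.1 z.2) (z.1, z.2) :=
    (hf.contDiffAt (hQ.mem_nhds hz)).differentiableAt one_ne_zero
  have hi : HasFDerivAt (fun y : Euc N => (z.1, y)) (ContinuousLinearMap.inr ℝ ℝ (Euc N)) z.2 :=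
    hasFDerivAt_prodMk_right z.1 z.2
  exact (hd.hasFDerivAt.comp z.2 hi).fderiv

/-- A weight `g = G'` on `[0, ∞)` that is nonnegative and nondecreasing, and satisfies a Young
inequality with exponent `m`: in the energy estimate for `∫ G(|Du|²)` it allows to absorb the
forcing term `2 g(|Du|²) Du · Df` by Gronwall's argument. -/
structure IsWeight (m : ℝ) (g G : ℝ → ℝ) : Prop where
  contDiffAt : ∀ s, 0 ≤ s → ContDiffAt ℝ 1 g s
  nonneg : ∀ s, 0 ≤ s → 0 ≤ g s
  deriv_nonneg : ∀ s, 0 ≤ s → 0 ≤ deriv g s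
  hasDerivAt : ∀ s, 0 ≤ s → HasDerivAt G (g s) s
  primitive_nonneg : ∀ s, 0 ≤ s → 0 ≤ G s
  young : ∀ r b, 0 ≤ r → 0 ≤ b → 2 * g (r ^ 2) * r * b ≤ (m - 1) * G (r ^ 2) + b ^ m

theorem integrableOn_prod_cutoff_mul (hΩ : IsOpen Ω) (hb : Bornology.IsBounded Ω) {δ : ℝ}
    (hδ : 0 < δ) {s t : ℝ} (hs : 0 < s) (ht : t < T) {h : ℝ × Euc N → ℝ}
    (hh : ContinuousOn h (Ioo 0 T ×ˢ Ω)) :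
    IntegrableOn (fun z => cutoff Ω δ z.2 * h z) (Ioc s t ×ˢ Ω) := by
  have hK := hasCompactSupport_cutoff hb hδ
  have hsub : Icc s t ×ˢ tsupport (cutoff Ω δ) ⊆ Ioo 0 T ×ˢ Ω :=
    prod_mono (fun τ hτ => ⟨hs.trans_le hτ.1, hτ.2.trans_lt ht⟩) (tsupport_cutoff_subset_self hδ)
  have h1 : IntegrableOn (fun z : ℝ × Euc N => cutoff Ω δ z.2 * h z)
      (Icc s t ×ˢ tsupport (cutoff Ω δ)) :=
    ((((lipschitzWith_cutoff Ω hδ).continuous.comp continuous_snd).continuousOn).mul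
      (hh.mono hsub)).integrableOn_compact (isCompact_Icc.prod hK)
  refine h1.of_forall_sdiff_eq_zero (measurableSet_Ioc.prod hΩ.measurableSet) fun z hz => ?_
  have : z.2 ∉ tsupport (cutoff Ω δ) := fun h => hz.2 ⟨Ioc_subset_Icc_self hz.1.1, h⟩
  rw [image_eq_zero_of_notMem_tsupport this, zero_mul]

variable {α : ℝ → ℝ} {ε : ℝ} {u₀ : Euc N → ℝ} {Du₀ : Euc N → Euc N} {m : ℝ} {g G : ℝ → ℝ}

theorem IsParabolicSmooth.hasDerivAt_exp_mul_primitive (hu : IsParabolicSmooth Ω T u)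
    (hΩ : IsOpen Ω) (hw : IsWeight m g G) {τ : ℝ} (hτ : τ ∈ Ioo 0 T) {x : Euc N} (hx : x ∈ Ω) :
    HasDerivAt (fun τ => Real.exp (-(m - 1) * τ) * G (‖gradient (u τ) x‖ ^ 2))
      (Real.exp (-(m - 1) * τ) * (2 * g (‖gradient (u τ) x‖ ^ 2) *
          inner ℝ (gradient (fun y => deriv (fun s => u s y) τ) x) (gradient (u τ) x)
        - (m - 1) * G (‖gradient (u τ) x‖ ^ 2))) τ := by
  have h1 : HasDerivAt (fun τ => Real.exp (-(m - 1) * τ))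
      (Real.exp (-(m - 1) * τ) * (-(m - 1))) τ := by
    have : HasDerivAt (fun τ => -(m - 1) * τ) (-(m - 1)) τ := by
      simpa using (hasDerivAt_id τ).const_mul (-(m - 1))
    exact this.exp
  have h2 := (hu.hasDerivAt_gradient hΩ hτ hx).norm_sq
  have h3 := (hw.hasDerivAt _ (sq_nonneg ‖gradient (u τ) x‖)).comp τ h2
  refine (h1.mul h3).congr_deriv ?_
  rw [real_inner_comm]
  simp only [Function.comp_apply]
  ring

/-- The time evolution of `e^{-(m-1)τ} G(|Du|²)` at an interior point: the Young inequality of the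
weight absorbs the forcing term, and only the diffusion term and `|Df|^m` remain. -/
theorem IsParabolicSmooth.exp_mul_primitive_sub_le (hu : IsParabolicSmooth Ω T u) (hΩ : IsOpen Ω)
    (hc : Convex ℝ Ω) (hne : Ω.Nonempty) (hm : 1 < m)
    (hf : ContDiffOn ℝ 1 (fun z : ℝ × Euc N => f z.1 z.2) (Ioo 0 T ×ˢ Ω)) (hw : IsWeight m g G)
    {s t : ℝ} (hs : 0 < s) (hst : s ≤ t) (ht : t < T) {x : Euc N} (hx : x ∈ Ω) :
    Real.exp (-(m - 1) * t) * G (‖gradient (u t) x‖ ^ 2) -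
        Real.exp (-(m - 1) * s) * G (‖gradient (u s) x‖ ^ 2) ≤
      ∫ τ in Ioc s t, (Real.exp (-(m - 1) * τ) * (2 * (g (‖gradient (u τ) x‖ ^ 2) *
          inner ℝ (gradient (fun y => deriv (fun s => u s y) τ) x - gradient (f τ) x)
            (gradient (u τ) x))) + ‖gradient (f τ) x‖ ^ m) := by
  have hIcc : Icc s t ⊆ Ioo 0 T := fun τ hτ => ⟨hs.trans_le hτ.1, hτ.2.trans_lt ht⟩
  have hsl : ∀ {E : Type} [TopologicalSpace E] {h : ℝ × Euc N → E},
      ContinuousOn h (Ioo 0 T ×ˢ Ω) → ContinuousOn (fun τ => h (τ, x)) (Icc s t) :=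
    fun hh => hh.comp (by fun_prop) fun τ hτ => ⟨hIcc hτ, hx⟩
  have hcV := hsl (hu.continuousOn_gradient hΩ hc hne)
  have hcVt := hsl hu.continuousOn_time_gradient
  have hcf := hsl (continuousOn_gradient_slice hΩ hf)
  have hcg : ContinuousOn (fun τ => g (‖gradient (u τ) x‖ ^ 2)) (Icc s t) := fun τ hτ =>
    (hw.contDiffAt _ (sq_nonneg _)).continuousAt.comp_continuousWithinAt
      (f := fun τ => ‖gradient (u τ) x‖ ^ 2) ((hcV τ hτ).norm.pow 2)
  have hcG : ContinuousOn (fun τ => G (‖gradient (u τ) x‖ ^ 2)) (Icc s t) := fun τ hτ =>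
    (hw.hasDerivAt _ (sq_nonneg _)).continuousAt.comp_continuousWithinAt
      (f := fun τ => ‖gradient (u τ) x‖ ^ 2) ((hcV τ hτ).norm.pow 2)
  have hce : ContinuousOn (fun τ => Real.exp (-(m - 1) * τ)) (Icc s t) := by fun_prop
  have hc1 : ContinuousOn (fun τ => Real.exp (-(m - 1) * τ) *
      (2 * g (‖gradient (u τ) x‖ ^ 2) *
          inner ℝ (gradient (fun y => deriv (fun s => u s y) τ) x) (gradient (u τ) x)
        - (m - 1) * G (‖gradient (u τ) x‖ ^ 2))) (Icc s t) :=
    hce.mul (((continuousOn_const.mul hcg).mul (hcVt.inner hcV)).sub (continuousOn_const.mul hcG))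
  have hc2 : ContinuousOn (fun τ => Real.exp (-(m - 1) * τ) * (2 * (g (‖gradient (u τ) x‖ ^ 2) *
          inner ℝ (gradient (fun y => deriv (fun s => u s y) τ) x - gradient (f τ) x)
            (gradient (u τ) x))) + ‖gradient (f τ) x‖ ^ m) (Icc s t) :=
    (hce.mul (continuousOn_const.mul (hcg.mul ((hcVt.sub hcf).inner hcV)))).add
      (hcf.norm.rpow_const fun _ _ => Or.inr (by linarith))
  rw [← intervalIntegral.integral_of_le hst, ← intervalIntegral.integral_eq_sub_of_hasDerivAt
    (fun τ hτ => hu.hasDerivAt_exp_mul_primitive hΩ hw (hIcc (uIcc_of_le hst ▸ hτ)) hx)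
    (hc1.intervalIntegrable_of_Icc hst)]
  refine intervalIntegral.integral_mono_on hst (hc1.intervalIntegrable_of_Icc hst)
    (hc2.intervalIntegrable_of_Icc hst) fun τ hτ => ?_
  have hτ0 : 0 < τ := (hIcc hτ).1
  set V := gradient (u τ) x
  set F := gradient (f τ) x
  set W := gradient (fun y => deriv (fun s => u s y) τ) x
  have hy := hw.young ‖V‖ ‖F‖ (norm_nonneg _) (norm_nonneg _)
  have hgn := hw.nonneg _ (sq_nonneg ‖V‖)
  have hin : 2 * g (‖V‖ ^ 2) * inner ℝ F V ≤ (m - 1) * G (‖V‖ ^ 2) + ‖F‖ ^ m := by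
    refine le_trans ?_ hy
    have := real_inner_le_norm F V
    nlinarith
  have he0 : 0 < Real.exp (-(m - 1) * τ) := Real.exp_pos _
  have he1 : Real.exp (-(m - 1) * τ) ≤ 1 := Real.exp_le_one_iff.2 (by nlinarith)
  have hF : 0 ≤ ‖F‖ ^ m := by positivity
  rw [inner_sub_left]
  have h1 : Real.exp (-(m - 1) * τ) * (2 * g (‖V‖ ^ 2) * inner ℝ F V - (m - 1) * G (‖V‖ ^ 2)) ≤
      Real.exp (-(m - 1) * τ) * ‖F‖ ^ m := by gcongr; linarith
  have h2 : Real.exp (-(m - 1) * τ) * ‖F‖ ^ m ≤ ‖F‖ ^ m := mul_le_of_le_one_left hF he1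
  nlinarith

/-- The energy inequality localized by the cutoff: the pointwise evolution is integrated in space,
the order of integration is exchanged, and the diffusion term is bounded at each time. -/
theorem IsSolution.setIntegral_cutoff_mul_sub_le (hΩ : IsOpen Ω) (hc : Convex ℝ Ω)
    (hne : Ω.Nonempty) (hb : Bornology.IsBounded Ω) (hu : IsSolution Ω T α ε f u₀ Du₀ u)
    (ha : IsElliptic (regCoeff α ε)) (hm : 1 < m)
    (hf : ContDiffOn ℝ 1 (fun z : ℝ × Euc N => f z.1 z.2) (Ioo 0 T ×ˢ Ω))
    (hDf : IntegrableOn (fun z : ℝ × Euc N => ‖gradient (f z.1) z.2‖ ^ m) (Ioo 0 T ×ˢ Ω))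
    (hw : IsWeight m g G) {s t : ℝ} (hs : 0 < s) (hst : s ≤ t) (ht : t < T) {β δ : ℝ} (hβ : 0 ≤ β)
    (hδ : 0 < δ) (hflux : ∀ τ ∈ Icc s t,
      ∫ x in Ω, cutoff Ω δ x * (g (‖gradient (u τ) x‖ ^ 2) *
        fderiv ℝ (divergence fun z => flux (regCoeff α ε) (gradient (u τ) z)) x
          (gradient (u τ) x)) ≤ β) :
    ∫ x in Ω, cutoff Ω δ x * (Real.exp (-(m - 1) * t) * G (‖gradient (u t) x‖ ^ 2) -
        Real.exp (-(m - 1) * s) * G (‖gradient (u s) x‖ ^ 2)) ≤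
      2 * β * (t - s) + ∫ z in Ioo 0 T ×ˢ Ω, ‖gradient (f z.1) z.2‖ ^ m := by
  have hIcc : Icc s t ⊆ Ioo 0 T := fun τ hτ => ⟨hs.trans_le hτ.1, hτ.2.trans_lt ht⟩
  have hcV := hu.smooth.continuousOn_gradient hΩ hc hne
  have hcf := continuousOn_gradient_slice hΩ hf
  set H : ℝ × Euc N → ℝ := fun z => Real.exp (-(m - 1) * z.1) *
    (2 * (g (‖gradient (u z.1) z.2‖ ^ 2) *
      inner ℝ (gradient (fun y => deriv (fun s => u s y) z.1) z.2 - gradient (f z.1) z.2)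
        (gradient (u z.1) z.2))) with hH
  set D : ℝ × Euc N → ℝ := fun z => ‖gradient (f z.1) z.2‖ ^ m with hD
  have hcg : ContinuousOn (fun z : ℝ × Euc N => g (‖gradient (u z.1) z.2‖ ^ 2)) (Ioo 0 T ×ˢ Ω) :=
    fun z hz => (hw.contDiffAt _ (sq_nonneg _)).continuousAt.comp_continuousWithinAt
      (f := fun z : ℝ × Euc N => ‖gradient (u z.1) z.2‖ ^ 2) ((hcV z hz).norm.pow 2)
  have hcH : ContinuousOn H (Ioo 0 T ×ˢ Ω) := by
    have hce : ContinuousOn (fun z : ℝ × Euc N => Real.exp (-(m - 1) * z.1)) (Ioo 0 T ×ˢ Ω) := by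
      fun_prop
    exact hce.mul (continuousOn_const.mul
      (hcg.mul ((hu.smooth.continuousOn_time_gradient.sub hcf).inner hcV)))
  have hcD : ContinuousOn D (Ioo 0 T ×ˢ Ω) :=
    hcf.norm.rpow_const fun _ _ => Or.inr (by linarith)
  have hiH := integrableOn_prod_cutoff_mul hΩ hb hδ hs ht hcH
  have hiD := integrableOn_prod_cutoff_mul hΩ hb hδ hs ht hcD
  have hiP : IntegrableOn (fun z => cutoff Ω δ z.2 * (H z + D z)) (Ioc s t ×ˢ Ω) :=
    integrableOn_prod_cutoff_mul hΩ hb hδ hs ht (hcH.add hcD)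
  have hprod : (volume : Measure (ℝ × Euc N)).restrict (Ioc s t ×ˢ Ω) =
      (volume.restrict (Ioc s t)).prod (volume.restrict Ω) := by
    rw [Measure.prod_restrict, Measure.volume_eq_prod]
  have hGc : ∀ τ ∈ Icc s t, ContinuousOn (fun x => G (‖gradient (u τ) x‖ ^ 2)) Ω :=
    fun τ hτ x hx => (hw.hasDerivAt _ (sq_nonneg _)).continuousAt.comp_continuousWithinAt
      (f := fun x => ‖gradient (u τ) x‖ ^ 2)
      (((hcV.comp (f := fun x => (τ, x)) (by fun_prop) fun x hx => ⟨hIcc hτ, hx⟩) x hx).norm.pow 2)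
  calc _ ≤ ∫ x in Ω, ∫ τ in Ioc s t, cutoff Ω δ x * (H (τ, x) + D (τ, x)) := by
        refine setIntegral_mono_on (integrableOn_cutoff_mul hΩ hb hδ ?_) ?_ hΩ.measurableSet ?_
        · exact (continuousOn_const.mul (hGc t ⟨hst, le_rfl⟩)).sub
            (continuousOn_const.mul (hGc s ⟨le_rfl, hst⟩))
        · rw [IntegrableOn, hprod] at hiP
          exact hiP.integral_prod_right
        · intro x hx
          rw [integral_const_mul]
          exact mul_le_mul_of_nonneg_left
            (hu.smooth.exp_mul_primitive_sub_le hΩ hc hne hm hf hw hs hst ht hx)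
            (cutoff_nonneg _ _ _)
    _ = ∫ z in Ioc s t ×ˢ Ω, cutoff Ω δ z.2 * (H z + D z) := by
        rw [IntegrableOn, hprod] at hiP
        rw [hprod, integral_prod_symm _ hiP]
    _ = (∫ z in Ioc s t ×ˢ Ω, cutoff Ω δ z.2 * H z) +
          ∫ z in Ioc s t ×ˢ Ω, cutoff Ω δ z.2 * D z := by
        rw [← integral_add hiH hiD]
        simp only [mul_add]
    _ ≤ 2 * β * (t - s) + ∫ z in Ioo 0 T ×ˢ Ω, D z := by
        refine add_le_add ?_ ?_
        · rw [IntegrableOn, hprod] at hiH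
          rw [hprod, integral_prod _ hiH]
          have hconst : ∫ _ in Ioc s t, 2 * β = 2 * β * (t - s) := by
            rw [setIntegral_const, Real.volume_real_Ioc_of_le hst, smul_eq_mul, mul_comm]
          rw [← hconst]
          refine setIntegral_mono_on hiH.integral_prod_left
            (integrableOn_const measure_Ioc_lt_top.ne) measurableSet_Ioc fun τ hτ => ?_
          have hτ' := hIcc (Ioc_subset_Icc_self hτ)
          have heq : ∫ x in Ω, cutoff Ω δ x * H (τ, x) = Real.exp (-(m - 1) * τ) * 2 *
              ∫ x in Ω, cutoff Ω δ x * (g (‖gradient (u τ) x‖ ^ 2) *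
                fderiv ℝ (divergence fun z => flux (regCoeff α ε) (gradient (u τ) z)) x
                  (gradient (u τ) x)) := by
            rw [← integral_const_mul]
            refine setIntegral_congr_fun hΩ.measurableSet fun x hx => ?_
            simp only [hH]
            rw [hu.fderiv_divergence_flux_eq hΩ ha hτ' (contDiffOn_slice hf hτ') hx]
            ring
          have he0 : 0 < Real.exp (-(m - 1) * τ) := Real.exp_pos _
          have he1 : Real.exp (-(m - 1) * τ) ≤ 1 :=
            Real.exp_le_one_iff.2 (by nlinarith [hτ'.1])
          simp only
          rw [heq]
          calc _ ≤ Real.exp (-(m - 1) * τ) * 2 * β := by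
                gcongr
                exact hflux τ (Ioc_subset_Icc_self hτ)
            _ ≤ 2 * β := by nlinarith
        · have hsub : Ioc s t ×ˢ Ω ⊆ Ioo 0 T ×ˢ Ω :=
            prod_mono (Ioc_subset_Icc_self.trans hIcc) subset_rfl
          have hD0 : ∀ z, 0 ≤ D z := fun z => by positivity
          refine (setIntegral_mono_on hiD (hDf.mono_set hsub)
            (measurableSet_Ioc.prod hΩ.measurableSet)
            fun z _ => mul_le_of_le_one_left (hD0 z) (cutoff_le_one _ _ _)).trans ?_
          exact setIntegral_mono_set hDf (ae_of_all _ hD0) (Filter.Eventually.of_forall hsub)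

/-- The energy inequality between two positive times. -/
theorem IsSolution.setIntegral_primitive_le (hΩ : IsOpen Ω) (hc : Convex ℝ Ω)
    (hne : Ω.Nonempty) (hne' : Ωᶜ.Nonempty) (hvol : volume Ω < ⊤) (hC1 : HasC1Boundary Ω)
    (hu : IsSolution Ω T α ε f u₀ Du₀ u)
    (ha : IsElliptic (regCoeff α ε)) (hm : 1 < m)
    (hf : ContDiffOn ℝ 1 (fun z : ℝ × Euc N => f z.1 z.2) (Ioo 0 T ×ˢ Ω))
    (hDf : IntegrableOn (fun z : ℝ × Euc N => ‖gradient (f z.1) z.2‖ ^ m) (Ioo 0 T ×ˢ Ω))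
    (hw : IsWeight m g G) {s t : ℝ} (hs : 0 < s) (hst : s ≤ t) (ht : t < T) :
    IntegrableOn (fun x => G (‖gradient (u t) x‖ ^ 2)) Ω ∧
    ∫ x in Ω, G (‖gradient (u t) x‖ ^ 2) ≤ Real.exp ((m - 1) * t) *
      ((∫ x in Ω, G (‖gradient (u s) x‖ ^ 2)) +
        ∫ z in Ioo 0 T ×ˢ Ω, ‖gradient (f z.1) z.2‖ ^ m) := by
  have hb := isBounded_of_volume_lt_top hΩ hc hne hvol
  have hcl := hu.smooth.continuousOn_gradientWithin hΩ hc hne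
  have hint : ∀ τ ∈ Ioo 0 T, IntegrableOn (fun x => G (‖gradient (u τ) x‖ ^ 2)) Ω := by
    intro τ hτ
    have h1 : ContinuousOn (fun x => G (‖gradientWithin (u τ) (closure Ω) x‖ ^ 2)) (closure Ω) :=
      fun x hx => (hw.hasDerivAt _ (sq_nonneg _)).continuousAt.comp_continuousWithinAt
        (f := fun x => ‖gradientWithin (u τ) (closure Ω) x‖ ^ 2)
        (((hcl.comp (f := fun x => (τ, x)) (by fun_prop) fun x hx => ⟨hτ, hx⟩) x hx).norm.pow 2)
    have h2 := (h1.integrableOn_compact (μ := volume) hb.isCompact_closure).mono_set subset_closure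
    refine h2.congr_fun (fun x hx => ?_) hΩ.measurableSet
    simp only
    rw [gradientWithin_closure_eq hΩ hx]
  have hs' : s ∈ Ioo 0 T := ⟨hs, hst.trans_lt ht⟩
  have ht' : t ∈ Ioo 0 T := ⟨hs.trans_le hst, ht⟩
  refine ⟨hint t ht', ?_⟩
  set B := ∫ z in Ioo 0 T ×ˢ Ω, ‖gradient (f z.1) z.2‖ ^ m with hB
  set φ : ℝ → Euc N → ℝ := fun τ x => Real.exp (-(m - 1) * τ) * G (‖gradient (u τ) x‖ ^ 2) with hφ
  have hφi : ∀ τ ∈ Ioo 0 T, IntegrableOn (φ τ) Ω := fun τ hτ => (hint τ hτ).const_mul _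
  -- as the width of the cutoff tends to zero, the localized integrals converge
  have hlim : Tendsto (fun n : ℕ => ∫ x in Ω, cutoff Ω (1 / ((n : ℝ) + 1)) x * (φ t x - φ s x))
      atTop (𝓝 (∫ x in Ω, (φ t x - φ s x))) := by
    have hi : IntegrableOn (fun x => φ t x - φ s x) Ω := (hφi t ht').sub (hφi s hs')
    refine tendsto_integral_of_dominated_convergence (fun x => ‖φ t x - φ s x‖) ?_ hi.norm ?_ ?_
    · intro n
      exact ((lipschitzWith_cutoff Ω (by positivity)).continuous.aestronglyMeasurable).mul
        hi.aestronglyMeasurable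
    · intro n
      refine ae_of_all _ fun x => ?_
      rw [norm_mul, Real.norm_of_nonneg (cutoff_nonneg _ _ _)]
      exact mul_le_of_le_one_left (norm_nonneg _) (cutoff_le_one _ _ _)
    · refine (ae_restrict_iff' hΩ.measurableSet).2 (ae_of_all _ fun x hx => ?_)
      have hd0 : 0 < Metric.infDist x Ωᶜ := by
        rw [← hΩ.isClosed_compl.notMem_iff_infDist_pos hne']
        exact fun h => h hx
      refine tendsto_const_nhds.congr' ?_
      have := (tendsto_one_div_add_atTop_nhds_zero_nat (𝕜 := ℝ)).eventually
        (gt_mem_nhds (half_pos hd0))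
      filter_upwards [this] with n hn
      rw [cutoff_eq_one (by positivity) (by linarith), one_mul]
  have hle : ∫ x in Ω, (φ t x - φ s x) ≤ B := by
    refine le_of_forall_pos_le_add fun κ hκ => ?_
    have hT : 0 < T := hs'.1.trans hs'.2
    set β := κ / (2 * T) with hβ
    have hβ0 : 0 < β := by positivity
    obtain ⟨δ₁, hδ₁, hδ⟩ := hu.exists_setIntegral_cutoff_le hΩ hc hne hne' hvol hC1 ha
      hw.contDiffAt hw.nonneg hw.deriv_nonneg hs ht hβ0
    refine le_of_tendsto hlim ?_
    have := (tendsto_one_div_add_atTop_nhds_zero_nat (𝕜 := ℝ)).eventually (gt_mem_nhds hδ₁)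
    filter_upwards [this] with n hn
    have h := hu.setIntegral_cutoff_mul_sub_le hΩ hc hne hb ha hm hf hDf hw hs hst ht hβ0.le
      (by positivity) (hδ _ (by positivity) hn.le)
    refine h.trans ?_
    have : 2 * β * (t - s) ≤ κ := by
      calc 2 * β * (t - s) ≤ 2 * β * T := by gcongr; linarith
        _ = κ := by rw [hβ]; field_simp
    linarith
  rw [integral_sub (hφi t ht') (hφi s hs'), integral_const_mul, integral_const_mul] at hle
  have hG0 : 0 ≤ ∫ x in Ω, G (‖gradient (u s) x‖ ^ 2) :=
    integral_nonneg fun x => hw.primitive_nonneg _ (sq_nonneg _)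
  have he1 : Real.exp (-(m - 1) * s) ≤ 1 := Real.exp_le_one_iff.2 (by nlinarith)
  have h1 : Real.exp (-(m - 1) * t) * ∫ x in Ω, G (‖gradient (u t) x‖ ^ 2) ≤
      (∫ x in Ω, G (‖gradient (u s) x‖ ^ 2)) + B := by
    have := mul_le_of_le_one_left hG0 he1
    linarith
  have h2 : Real.exp ((m - 1) * t) * Real.exp (-(m - 1) * t) = 1 := by
    rw [← Real.exp_add, neg_mul, add_neg_cancel, Real.exp_zero]
  calc ∫ x in Ω, G (‖gradient (u t) x‖ ^ 2) = Real.exp ((m - 1) * t) *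
        (Real.exp (-(m - 1) * t) * ∫ x in Ω, G (‖gradient (u t) x‖ ^ 2)) := by
        rw [← mul_assoc, h2, one_mul]
    _ ≤ _ := by gcongr

end

/-! ### Weights of linear growth approximating the powers -/

section

/-- A bounded, concave approximation of `w ↦ w` on `[0, ∞)`, bounded away from zero. -/
noncomputable def truncation (κ w : ℝ) : ℝ := κ + w / (1 + κ * w)

/-- The weight `(m/2) h^((m-2)/2)`, where `h` is the truncation of the identity. -/
noncomputable def truncatedWeight (m κ w : ℝ) : ℝ := m / 2 * truncation κ w ^ ((m - 2) / 2)

/-- The primitive of the truncated weight; it lies between `h^(m/2)` and `(w + κ)^(m/2)`, and it has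
linear growth. -/
noncomputable def truncatedPower (m κ w : ℝ) : ℝ :=
  κ ^ (m / 2) + ∫ s in (0 : ℝ)..w, truncatedWeight m κ s

theorem nonneg_of_hasDerivAt_nonneg {D D' : ℝ → ℝ} (h0 : 0 ≤ D 0)
    (hD : ∀ s, 0 ≤ s → HasDerivAt D (D' s) s) (hD' : ∀ s, 0 ≤ s → 0 ≤ D' s) {w : ℝ} (hw : 0 ≤ w) :
    0 ≤ D w := by
  have hmono : MonotoneOn D (Ici 0) := by
    refine monotoneOn_of_hasDerivWithinAt_nonneg (convex_Ici 0)
      (fun s hs => (hD s hs).continuousAt.continuousWithinAt)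
      (fun s hs => (hD s (interior_subset hs)).hasDerivWithinAt)
      fun s hs => hD' s (interior_subset hs)
  exact h0.trans (hmono self_mem_Ici hw hw)

section Truncation

variable {m κ : ℝ}

theorem le_truncation (hκ : 0 < κ) {w : ℝ} (hw : 0 ≤ w) : κ ≤ truncation κ w := by
  rw [truncation]
  have : 0 ≤ w / (1 + κ * w) := by positivity
  linarith

theorem truncation_pos (hκ : 0 < κ) {w : ℝ} (hw : 0 ≤ w) : 0 < truncation κ w :=
  hκ.trans_le (le_truncation hκ hw)

theorem truncation_le_add (hκ : 0 < κ) {w : ℝ} (hw : 0 ≤ w) : truncation κ w ≤ w + κ := by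
  have h1 : 0 ≤ κ * w := by positivity
  have : w / (1 + κ * w) ≤ w := div_le_self hw (by linarith)
  rw [truncation]
  linarith

theorem truncation_le_const (hκ : 0 < κ) {w : ℝ} (hw : 0 ≤ w) : truncation κ w ≤ κ + 1 / κ := by
  have h1 : 0 < 1 + κ * w := by positivity
  have : w / (1 + κ * w) ≤ 1 / κ := by
    rw [div_le_div_iff₀ h1 hκ]
    linarith
  rw [truncation]
  linarith

theorem hasDerivAt_truncation (hκ : 0 < κ) {w : ℝ} (hw : 0 ≤ w) :
    HasDerivAt (truncation κ) (1 / (1 + κ * w) ^ 2) w := by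
  have h1 : 1 + κ * w ≠ 0 := by positivity
  have h2 : HasDerivAt (fun w => 1 + κ * w) κ w := by
    simpa using ((hasDerivAt_id w).const_mul κ).const_add 1
  refine (((hasDerivAt_id w).div h2 h1).const_add κ).congr_deriv ?_
  simp only [id]
  congr 1
  ring

theorem contDiffAt_truncation (hκ : 0 < κ) {w : ℝ} (hw : 0 ≤ w) :
    ContDiffAt ℝ 1 (truncation κ) w := by
  have h1 : 1 + κ * w ≠ 0 := by positivity
  exact contDiffAt_const.add (contDiffAt_id.div (by fun_prop) h1)

theorem contDiffAt_truncatedWeight (hκ : 0 < κ) {w : ℝ} (hw : 0 ≤ w) :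
    ContDiffAt ℝ 1 (truncatedWeight m κ) w :=
  contDiffAt_const.mul ((contDiffAt_truncation hκ hw).rpow_const_of_ne (truncation_pos hκ hw).ne')

theorem hasDerivAt_truncation_rpow (hκ : 0 < κ) {w : ℝ} (hw : 0 ≤ w) (q : ℝ) :
    HasDerivAt (fun w => truncation κ w ^ q)
      (1 / (1 + κ * w) ^ 2 * q * truncation κ w ^ (q - 1)) w :=
  (hasDerivAt_truncation hκ hw).rpow_const (Or.inl (truncation_pos hκ hw).ne')

theorem truncatedWeight_nonneg (hm : 2 < m) (hκ : 0 < κ) {w : ℝ} (hw : 0 ≤ w) :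
    0 ≤ truncatedWeight m κ w := by
  have := truncation_pos hκ hw
  rw [truncatedWeight]
  have : 0 ≤ m / 2 := by linarith
  positivity

theorem deriv_truncatedWeight_nonneg (hm : 2 < m) (hκ : 0 < κ) {w : ℝ} (hw : 0 ≤ w) :
    0 ≤ deriv (truncatedWeight m κ) w := by
  have h := ((hasDerivAt_truncation_rpow hκ hw ((m - 2) / 2)).const_mul (m / 2)).deriv
  change deriv (truncatedWeight m κ) w = _ at h
  rw [h]
  have := truncation_pos hκ hw
  have h1 : 0 ≤ m / 2 := by linarith
  have h2 : 0 ≤ (m - 2) / 2 := by linarith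
  positivity

theorem truncatedWeight_le (hm : 2 < m) (hκ : 0 < κ) {w : ℝ} (hw : 0 ≤ w) :
    truncatedWeight m κ w ≤ m / 2 * (κ + 1 / κ) ^ ((m - 2) / 2) := by
  have h1 : 0 ≤ m / 2 := by linarith
  have h2 : 0 ≤ (m - 2) / 2 := by linarith
  have h3 := (truncation_pos hκ hw).le
  rw [truncatedWeight]
  gcongr
  exact truncation_le_const hκ hw

theorem hasDerivAt_truncatedPower (hκ : 0 < κ) {w : ℝ} (hw : 0 ≤ w) :
    HasDerivAt (truncatedPower m κ) (truncatedWeight m κ w) w := by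
  have hc : ContinuousOn (truncatedWeight m κ) (uIcc 0 w) := fun s hs =>
    (contDiffAt_truncatedWeight hκ
      (by rw [uIcc_of_le hw] at hs; exact hs.1)).continuousAt.continuousWithinAt
  have hmeas : Measurable (truncatedWeight m κ) := by
    unfold truncatedWeight truncation
    fun_prop
  exact (intervalIntegral.integral_hasDerivAt_right hc.intervalIntegrable
    hmeas.stronglyMeasurable.stronglyMeasurableAtFilter
    (contDiffAt_truncatedWeight hκ hw).continuousAt).const_add _

theorem truncatedPower_zero (m κ : ℝ) : truncatedPower m κ 0 = κ ^ (m / 2) := by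
  simp [truncatedPower]

theorem truncation_zero (κ : ℝ) : truncation κ 0 = κ := by simp [truncation]

theorem truncation_rpow_le_truncatedPower (hm : 2 < m) (hκ : 0 < κ) {w : ℝ} (hw : 0 ≤ w) :
    truncation κ w ^ (m / 2) ≤ truncatedPower m κ w := by
  refine sub_nonneg.1 (nonneg_of_hasDerivAt_nonneg
    (D := fun w => truncatedPower m κ w - truncation κ w ^ (m / 2)) ?_
    (fun s hs => (hasDerivAt_truncatedPower hκ hs).sub (hasDerivAt_truncation_rpow hκ hs _)) ?_ hw)
  · simp [truncatedPower_zero, truncation_zero]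
  · intro s hs
    have h1 : 0 ≤ truncation κ s ^ ((m - 2) / 2) := Real.rpow_nonneg (truncation_pos hκ hs).le _
    have h2 : 1 / (1 + κ * s) ^ 2 ≤ 1 := by
      rw [div_le_one (by positivity)]
      exact one_le_pow₀ (by linarith [mul_nonneg hκ.le hs])
    rw [truncatedWeight, show m / 2 - 1 = (m - 2) / 2 by ring, sub_nonneg]
    calc _ ≤ 1 * (m / 2) * truncation κ s ^ ((m - 2) / 2) := by gcongr
      _ = _ := by ring

/-- By concavity of the truncation `h`, `h' w ≤ h`, which makes `h^((m-2)/2) w` grow more slowly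
than the primitive of `(m/2) h^((m-2)/2)`. -/
theorem truncation_rpow_mul_le_truncatedPower (hm : 2 < m) (hκ : 0 < κ) {w : ℝ} (hw : 0 ≤ w) :
    truncation κ w ^ ((m - 2) / 2) * w ≤ truncatedPower m κ w := by
  refine sub_nonneg.1 (nonneg_of_hasDerivAt_nonneg
    (D := fun w => truncatedPower m κ w - truncation κ w ^ ((m - 2) / 2) * w) ?_
    (fun s hs => (hasDerivAt_truncatedPower hκ hs).sub
      ((hasDerivAt_truncation_rpow hκ hs _).mul (hasDerivAt_id s))) ?_ hw)
  · simp only [truncatedPower_zero, mul_zero, sub_zero]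
    positivity
  · intro s hs
    have h0 := truncation_pos hκ hs
    have h1 : truncation κ s ^ ((m - 2) / 2) =
        truncation κ s * truncation κ s ^ ((m - 2) / 2 - 1) := by
      rw [Real.rpow_sub_one h0.ne']
      field_simp
    have h2 : 1 / (1 + κ * s) ^ 2 * s ≤ truncation κ s := by
      have h3 : 1 ≤ 1 + κ * s := by linarith [mul_nonneg hκ.le hs]
      have h4 : 1 / (1 + κ * s) ^ 2 * s ≤ s / (1 + κ * s) := by
        rw [one_div_mul_eq_div]
        gcongr
        nlinarith
      rw [truncation]
      linarith
    have h5 : 0 ≤ truncation κ s ^ ((m - 2) / 2 - 1) := Real.rpow_nonneg h0.le _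
    simp only [truncatedWeight]
    rw [h1]
    have h6 : 0 ≤ (m - 2) / 2 * truncation κ s ^ ((m - 2) / 2 - 1) *
        (truncation κ s - 1 / (1 + κ * s) ^ 2 * s) :=
      mul_nonneg (mul_nonneg (by linarith) h5) (by linarith)
    linarith

theorem truncatedPower_le (hm : 2 < m) (hκ : 0 < κ) {w : ℝ} (hw : 0 ≤ w) :
    truncatedPower m κ w ≤ (w + κ) ^ (m / 2) := by
  refine sub_nonneg.1 (nonneg_of_hasDerivAt_nonneg
    (D := fun w => (w + κ) ^ (m / 2) - truncatedPower m κ w) ?_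
    (fun s hs => (((hasDerivAt_id s).add_const κ).rpow_const (p := m / 2)
      (Or.inr (by linarith))).sub (hasDerivAt_truncatedPower hκ hs)) ?_ hw)
  · simp [truncatedPower_zero]
  · intro s hs
    have h1 := truncation_le_add hκ hs
    have h2 := (truncation_pos hκ hs).le
    have h3 : 0 ≤ (m - 2) / 2 := by linarith
    simp only [id]
    rw [truncatedWeight, show m / 2 - 1 = (m - 2) / 2 by ring, sub_nonneg, one_mul]
    gcongr

theorem isWeight_truncatedWeight (hm : 2 < m) (hκ : 0 < κ) :
    IsWeight m (truncatedWeight m κ) (truncatedPower m κ) where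
  contDiffAt s hs := contDiffAt_truncatedWeight hκ hs
  nonneg s hs := truncatedWeight_nonneg hm hκ hs
  deriv_nonneg s hs := deriv_truncatedWeight_nonneg hm hκ hs
  hasDerivAt s hs := hasDerivAt_truncatedPower hκ hs
  primitive_nonneg s hs := (Real.rpow_nonneg (truncation_pos hκ hs).le _).trans
    (truncation_rpow_le_truncatedPower hm hκ hs)
  young r b hr hb := by
    have hw : 0 ≤ r ^ 2 := sq_nonneg r
    have h0 := truncation_pos hκ hw
    have h1 := truncation_rpow_le_truncatedPower hm hκ hw
    have h2 := truncation_rpow_mul_le_truncatedPower hm hκ hw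
    set P := truncation κ (r ^ 2) ^ ((m - 2) / 2) with hP
    have hP0 : 0 ≤ P := Real.rpow_nonneg h0.le _
    -- weighted inequality of arithmetic and geometric means with weights `(m-2)/m` and `2/m`
    have h3 : P * b ^ 2 ≤ (m - 2) / m * truncation κ (r ^ 2) ^ (m / 2) + 2 / m * b ^ m := by
      have h := Real.geom_mean_le_arith_mean2_weighted (w₁ := (m - 2) / m) (w₂ := 2 / m)
        (p₁ := truncation κ (r ^ 2) ^ (m / 2)) (p₂ := b ^ m)
        (div_nonneg (by linarith) (by linarith)) (div_nonneg (by linarith) (by linarith))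
        (Real.rpow_nonneg h0.le _) (Real.rpow_nonneg hb _)
        (by rw [← add_div, sub_add_cancel, div_self (by linarith)])
      rw [← Real.rpow_mul h0.le, ← Real.rpow_mul hb,
        show m / 2 * ((m - 2) / m) = (m - 2) / 2 by field_simp,
        show m * (2 / m) = 2 by field_simp, Real.rpow_two] at h
      exact h
    rw [truncatedWeight, ← hP]
    have h4 : 2 * (m / 2 * P) * r * b ≤ m / 2 * (P * r ^ 2 + P * b ^ 2) := by
      nlinarith [mul_nonneg (mul_nonneg (by linarith : 0 ≤ m / 2) hP0) (sq_nonneg (r - b))]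
    refine h4.trans ?_
    calc m / 2 * (P * r ^ 2 + P * b ^ 2)
        ≤ m / 2 * (truncatedPower m κ (r ^ 2) +
          ((m - 2) / m * truncatedPower m κ (r ^ 2) + 2 / m * b ^ m)) := by
          have h5 : (m - 2) / m * truncation κ (r ^ 2) ^ (m / 2) ≤
              (m - 2) / m * truncatedPower m κ (r ^ 2) :=
            mul_le_mul_of_nonneg_left h1 (div_nonneg (by linarith) (by linarith))
          gcongr
          linarith
      _ = (m - 1) * truncatedPower m κ (r ^ 2) + b ^ m := by
          field_simp
          ring

end Truncation

/-- A primitive `G` of a bounded weight is Lipschitz from above. -/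
theorem IsWeight.primitive_le_add {m M : ℝ} {g G : ℝ → ℝ} (hw : IsWeight m g G)
    (hM : ∀ s, 0 ≤ s → g s ≤ M) {a b c : ℝ} (ha : 0 ≤ a) (hb : 0 ≤ b) (hc : 0 ≤ c)
    (hab : a ≤ b + c) : G a ≤ G b + M * c := by
  have hmono : ∀ x y, 0 ≤ x → x ≤ y → G x ≤ G y := fun x y hx hxy => by
    refine monotoneOn_of_hasDerivWithinAt_nonneg (f' := g) (convex_Ici 0)
      (fun s hs => (hw.hasDerivAt s hs).continuousAt.continuousWithinAt)
      (fun s hs => (hw.hasDerivAt s (interior_subset hs)).hasDerivWithinAt)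
      (fun s hs => hw.nonneg s (interior_subset hs)) hx (hx.trans hxy) hxy
  refine (hmono _ _ ha hab).trans ?_
  have h : 0 ≤ G b + M * c - G (b + c) := by
    refine nonneg_of_hasDerivAt_nonneg (D := fun c => G b + M * c - G (b + c))
      (D' := fun c => M - g (b + c)) (by simp) (fun s hs => ?_) (fun s hs => ?_) hc
    · have h1 : HasDerivAt (fun c => G (b + c)) (g (b + s)) s :=
        (hw.hasDerivAt (b + s) (by positivity)).comp_const_add b s
      have h2 : HasDerivAt (fun c => G b + M * c) M s := by
        simpa using ((hasDerivAt_id s).const_mul M).const_add (G b)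
      exact h2.sub h1
    · exact sub_nonneg.2 (hM _ (by positivity))
  linarith

end

/-! ### The initial time and the gradient bounds -/

section

variable {N : ℕ} {Ω : Set (Euc N)} {T : ℝ} {u : ℝ → Euc N → ℝ} {f : ℝ → Euc N → ℝ}
  {α : ℝ → ℝ} {ε : ℝ} {u₀ : Euc N → ℝ} {Du₀ : Euc N → Euc N}

theorem lintegral_enorm_rpow_eq {X E : Type*} [MeasurableSpace X] [NormedAddCommGroup E]
    {μ : Measure X} {p : ℝ≥0∞} (h0 : p ≠ 0) (ht : p ≠ ⊤) (F : X → E) :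
    ∫⁻ x, ‖F x‖ₑ ^ p.toReal ∂μ = eLpNorm F p μ ^ p.toReal := by
  rw [eLpNorm_eq_lintegral_rpow_enorm_toReal h0 ht, ← ENNReal.rpow_mul,
    one_div_mul_cancel (ENNReal.toReal_pos h0 ht).ne', ENNReal.rpow_one]

theorem ofReal_norm_rpow {E : Type*} [NormedAddCommGroup E] (v : E) {m : ℝ} (hm : 0 ≤ m) :
    ENNReal.ofReal (‖v‖ ^ m) = ‖v‖ₑ ^ m := by
  rw [← ENNReal.ofReal_rpow_of_nonneg (norm_nonneg _) hm, ofReal_norm]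

theorem aestronglyMeasurable_gradient (hu : IsParabolicSmooth Ω T u) (hΩ : IsOpen Ω)
    (hc : Convex ℝ Ω) (hne : Ω.Nonempty) {t : ℝ} (ht : t ∈ Ioo 0 T) :
    AEStronglyMeasurable (fun x => gradient (u t) x) (volume.restrict Ω) :=
  ((hu.continuousOn_gradient hΩ hc hne).comp (f := fun x => (t, x)) (by fun_prop)
    fun _ hx => ⟨ht, hx⟩).aestronglyMeasurable hΩ.measurableSet

/-- A function of linear growth in `|Du|²` inherits the initial value from the convergence of the
gradients in `L²`, up to an arbitrarily small multiple `θ` of `∫ |Du₀|²`. -/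
theorem IsWeight.lintegral_primitive_le {m M κ θ : ℝ} {g G : ℝ → ℝ} (hw : IsWeight m g G)
    (hM : ∀ s, 0 ≤ s → g s ≤ M) (hM0 : 0 ≤ M)
    (hG : ∀ s, 0 ≤ s → G s ≤ (s + κ) ^ (m / 2)) (hθ : 0 < θ) {μ : Measure (Euc N)}
    {V W : Euc N → Euc N} (hW : AEStronglyMeasurable W μ) :
    ∫⁻ x, ENNReal.ofReal (G (‖V x‖ ^ 2)) ∂μ ≤
      (∫⁻ x, ENNReal.ofReal ((‖W x‖ ^ 2 + κ) ^ (m / 2)) ∂μ) +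
        (ENNReal.ofReal (M * θ) * eLpNorm W 2 μ ^ (2 : ℝ) +
          ENNReal.ofReal (M * (1 + 1 / θ)) * eLpNorm (fun x => V x - W x) 2 μ ^ (2 : ℝ)) := by
  have hpt : ∀ x, ENNReal.ofReal (G (‖V x‖ ^ 2)) ≤
      ENNReal.ofReal ((‖W x‖ ^ 2 + κ) ^ (m / 2)) +
        (ENNReal.ofReal (M * θ) * ‖W x‖ₑ ^ (2 : ℝ) +
          ENNReal.ofReal (M * (1 + 1 / θ)) * ‖V x - W x‖ₑ ^ (2 : ℝ)) := by
    intro x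
    have hab : ‖V x‖ ^ 2 ≤ ‖W x‖ ^ 2 + (θ * ‖W x‖ ^ 2 + (1 + 1 / θ) * ‖V x - W x‖ ^ 2) := by
      have h1 : ‖V x‖ ≤ ‖W x‖ + ‖V x - W x‖ := by
        have := norm_add_le (W x) (V x - W x)
        rwa [add_sub_cancel] at this
      have h2 : 2 * ‖W x‖ * ‖V x - W x‖ ≤ θ * ‖W x‖ ^ 2 + 1 / θ * ‖V x - W x‖ ^ 2 := by
        have h3 : 0 ≤ 1 / θ * (θ * ‖W x‖ - ‖V x - W x‖) ^ 2 := by positivity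
        have h4 : 1 / θ * (θ * ‖W x‖ - ‖V x - W x‖) ^ 2 = θ * ‖W x‖ ^ 2 -
            2 * ‖W x‖ * ‖V x - W x‖ + 1 / θ * ‖V x - W x‖ ^ 2 := by
          field_simp
          ring
        linarith
      nlinarith [norm_nonneg (V x), norm_nonneg (W x), norm_nonneg (V x - W x)]
    have h := hw.primitive_le_add hM (sq_nonneg ‖V x‖) (sq_nonneg ‖W x‖) (by positivity) hab
    rw [← ofReal_norm_rpow _ zero_le_two, ← ofReal_norm_rpow _ zero_le_two,
      ← ENNReal.ofReal_mul (by positivity), ← ENNReal.ofReal_mul (by positivity),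
      ← ENNReal.ofReal_add (by positivity) (by positivity)]
    refine (ENNReal.ofReal_le_ofReal ?_).trans ENNReal.ofReal_add_le
    have h1 := hG _ (sq_nonneg ‖W x‖)
    rw [Real.rpow_two, Real.rpow_two]
    linarith
  have hm1 : AEMeasurable (fun x => ENNReal.ofReal ((‖W x‖ ^ 2 + κ) ^ (m / 2))) μ :=
    ((((hW.norm.aemeasurable.pow_const 2).add_const κ).pow_const (m / 2))).ennreal_ofReal
  have hm2 : AEMeasurable (fun x => ENNReal.ofReal (M * θ) * ‖W x‖ₑ ^ (2 : ℝ)) μ :=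
    (hW.enorm.pow_const _).const_mul _
  have h2 : (2 : ℝ≥0∞).toReal = 2 := by simp
  have e1 := lintegral_enorm_rpow_eq (μ := μ) two_ne_zero ENNReal.ofNat_ne_top W
  have e2 := lintegral_enorm_rpow_eq (μ := μ) two_ne_zero ENNReal.ofNat_ne_top fun x => V x - W x
  rw [h2] at e1 e2
  calc _ ≤ _ := lintegral_mono hpt
    _ = _ := by
      rw [lintegral_add_left' hm1, lintegral_add_left' hm2,
        lintegral_const_mul' _ _ ENNReal.ofReal_ne_top,
        lintegral_const_mul' _ _ ENNReal.ofReal_ne_top, e1, e2]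

/-- The energy inequality from the initial time on, for the truncated powers. -/
theorem IsSolution.lintegral_truncatedPower_le (hΩ : IsOpen Ω) (hc : Convex ℝ Ω)
    (hne : Ω.Nonempty) (hne' : Ωᶜ.Nonempty) (hvol : volume Ω < ⊤) (hC1 : HasC1Boundary Ω)
    (hu : IsSolution Ω T α ε f u₀ Du₀ u) (ha : IsElliptic (regCoeff α ε)) {m κ : ℝ} (hm : 2 < m)
    (hκ : 0 < κ) (hf : ContDiffOn ℝ 1 (fun z : ℝ × Euc N => f z.1 z.2) (Ioo 0 T ×ˢ Ω))
    (hDf : IntegrableOn (fun z : ℝ × Euc N => ‖gradient (f z.1) z.2‖ ^ m) (Ioo 0 T ×ˢ Ω))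
    (hDu₀ : MemLp Du₀ 2 (volume.restrict Ω)) {t : ℝ} (ht : t ∈ Ioo 0 T) :
    ∫⁻ x in Ω, ENNReal.ofReal (truncatedPower m κ (‖gradient (u t) x‖ ^ 2)) ≤
      ENNReal.ofReal (Real.exp ((m - 1) * t)) *
        ((∫⁻ x in Ω, ENNReal.ofReal ((‖Du₀ x‖ ^ 2 + κ) ^ (m / 2))) +
          ∫⁻ z in Ioo 0 T ×ˢ Ω, ‖gradient (f z.1) z.2‖ₑ ^ m) := by
  have hw := isWeight_truncatedWeight hm hκ
  set g := truncatedWeight m κ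
  set G := truncatedPower m κ
  set M := m / 2 * (κ + 1 / κ) ^ ((m - 2) / 2) with hM
  have hM0 : 0 ≤ M := by
    have : 0 ≤ m / 2 := by linarith
    positivity
  have hGn : ∀ v : Euc N, 0 ≤ G (‖v‖ ^ 2) := fun v => hw.primitive_nonneg _ (sq_nonneg _)
  set e := ENNReal.ofReal (Real.exp ((m - 1) * t)) with he
  set A := ∫⁻ x in Ω, ENNReal.ofReal ((‖Du₀ x‖ ^ 2 + κ) ^ (m / 2)) with hA
  set B := ∫⁻ z in Ioo 0 T ×ˢ Ω, ‖gradient (f z.1) z.2‖ₑ ^ m with hB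
  set L := eLpNorm Du₀ 2 (volume.restrict Ω) ^ (2 : ℝ) with hL
  have hLt : L ≠ ⊤ := ENNReal.rpow_ne_top_of_nonneg zero_le_two hDu₀.2.ne
  have hBeq : ENNReal.ofReal (∫ z in Ioo 0 T ×ˢ Ω, ‖gradient (f z.1) z.2‖ ^ m) = B := by
    rw [ofReal_integral_eq_lintegral_ofReal hDf (ae_of_all _ fun z => by positivity)]
    exact lintegral_congr fun z => ofReal_norm_rpow _ (by linarith)
  have hstep : ∀ s ∈ Ioc 0 t, ∀ θ, 0 < θ →
      ∫⁻ x in Ω, ENNReal.ofReal (G (‖gradient (u t) x‖ ^ 2)) ≤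
        e * (A + (ENNReal.ofReal (M * θ) * L + ENNReal.ofReal (M * (1 + 1 / θ)) *
          eLpNorm (fun x => gradient (u s) x - Du₀ x) 2 (volume.restrict Ω) ^ (2 : ℝ)) + B) := by
    intro s hs θ hθ
    have hEt := hu.setIntegral_primitive_le hΩ hc hne hne' hvol hC1 ha (by linarith) hf hDf hw
      hs.1 hs.2 ht.2
    have hEs := hu.setIntegral_primitive_le hΩ hc hne hne' hvol hC1 ha (by linarith) hf hDf hw
      hs.1 le_rfl (hs.2.trans_lt ht.2)
    rw [← ofReal_integral_eq_lintegral_ofReal hEt.1 (ae_of_all _ fun x => hGn _)]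
    refine (ENNReal.ofReal_le_ofReal hEt.2).trans ?_
    rw [ENNReal.ofReal_mul (Real.exp_pos _).le, ENNReal.ofReal_add
      (integral_nonneg fun x => hGn _) (integral_nonneg fun z => by positivity), hBeq,
      ofReal_integral_eq_lintegral_ofReal hEs.1 (ae_of_all _ fun x => hGn _)]
    gcongr
    exact hw.lintegral_primitive_le (fun s hs => truncatedWeight_le hm hκ hs) hM0
      (fun s hs => truncatedPower_le hm hκ hs) hθ hDu₀.1
  -- the initial time
  have hstep' : ∀ θ, 0 < θ →
      ∫⁻ x in Ω, ENNReal.ofReal (G (‖gradient (u t) x‖ ^ 2)) ≤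
        e * (A + (ENNReal.ofReal (M * θ) * L) + B) := by
    intro θ hθ
    have h0 : Tendsto (fun s => ENNReal.ofReal (M * (1 + 1 / θ)) *
        eLpNorm (fun x => gradient (u s) x - Du₀ x) 2 (volume.restrict Ω) ^ (2 : ℝ))
        (𝓝[>] 0) (𝓝 0) := by
      have h1 := ((ENNReal.continuous_rpow_const (y := (2 : ℝ))).tendsto 0).comp hu.initial_gradient
      rw [ENNReal.zero_rpow_of_pos two_pos] at h1
      have h2 := ENNReal.Tendsto.const_mul h1
        (Or.inr (ENNReal.ofReal_ne_top (r := M * (1 + 1 / θ))))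
      rwa [mul_zero] at h2
    have hlim := ENNReal.Tendsto.const_mul ((((h0.const_add (ENNReal.ofReal (M * θ) * L)).const_add
      A).add_const B)) (Or.inr (ENNReal.ofReal_ne_top (r := Real.exp ((m - 1) * t))))
    rw [add_zero] at hlim
    refine ge_of_tendsto hlim ?_
    filter_upwards [Ioc_mem_nhdsGT ht.1] with s hs
    exact hstep s hs θ hθ
  have h0 : Tendsto (fun θ => ENNReal.ofReal (M * θ) * L) (𝓝[>] (0 : ℝ)) (𝓝 0) := by
    have h1 : Tendsto (fun θ : ℝ => ENNReal.ofReal (M * θ)) (𝓝[>] 0) (𝓝 0) := by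
      have hc : Continuous fun θ : ℝ => ENNReal.ofReal (M * θ) :=
        ENNReal.continuous_ofReal.comp (by fun_prop)
      have := (hc.tendsto 0).mono_left (nhdsWithin_le_nhds (s := Ioi 0))
      simpa using this
    have h2 := ENNReal.Tendsto.mul_const h1 (Or.inr hLt)
    rwa [zero_mul] at h2
  have hlim := ENNReal.Tendsto.const_mul ((h0.const_add A).add_const B)
    (Or.inr (ENNReal.ofReal_ne_top (r := Real.exp ((m - 1) * t))))
  rw [add_zero] at hlim
  refine ge_of_tendsto hlim ?_
  filter_upwards [self_mem_nhdsWithin] with θ hθ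
  exact hstep' θ hθ

theorem lintegral_sq_add_rpow_le {X E : Type*} [MeasurableSpace X] [NormedAddCommGroup E]
    {μ : Measure X} {p : ℝ≥0∞} (hp : 1 ≤ p) (ht : p ≠ ⊤) {W : X → E}
    (hW : AEStronglyMeasurable W μ) {κ : ℝ} (hκ : 0 ≤ κ) :
    ∫⁻ x, ENNReal.ofReal ((‖W x‖ ^ 2 + κ) ^ (p.toReal / 2)) ∂μ ≤
      (eLpNorm W p μ + ENNReal.ofReal (√κ) * μ univ ^ (1 / p.toReal)) ^ p.toReal := by
  have h0 : p ≠ 0 := (zero_lt_one.trans_le hp).ne'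
  have hp0 : 0 < p.toReal := ENNReal.toReal_pos h0 ht
  have hpt : ∀ x, ENNReal.ofReal ((‖W x‖ ^ 2 + κ) ^ (p.toReal / 2)) ≤
      ‖‖W x‖ + √κ‖ₑ ^ p.toReal := by
    intro x
    rw [← ofReal_norm_rpow _ hp0.le, Real.norm_of_nonneg (by positivity)]
    refine ENNReal.ofReal_le_ofReal ?_
    have h1 : ‖W x‖ ^ 2 + κ ≤ (‖W x‖ + √κ) ^ 2 := by
      have := Real.sq_sqrt hκ
      nlinarith [mul_nonneg (norm_nonneg (W x)) (Real.sqrt_nonneg κ)]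
    calc (‖W x‖ ^ 2 + κ) ^ (p.toReal / 2) ≤ ((‖W x‖ + √κ) ^ 2) ^ (p.toReal / 2) := by gcongr
      _ = (‖W x‖ + √κ) ^ p.toReal := by
        rw [← Real.rpow_two, ← Real.rpow_mul (by positivity)]
        congr 1
        ring
  refine (lintegral_mono hpt).trans ?_
  rw [lintegral_enorm_rpow_eq h0 ht fun x => ‖W x‖ + √κ]
  gcongr
  refine (eLpNorm_add_le (f := fun x => ‖W x‖) (g := fun _ => √κ) hW.norm
    aestronglyMeasurable_const hp).trans ?_
  rw [eLpNorm_norm, eLpNorm_const' _ h0 ht, Real.enorm_of_nonneg (Real.sqrt_nonneg _)]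

theorem tendsto_truncation {κ : ℕ → ℝ} (hκ : Tendsto κ atTop (𝓝 0)) (w : ℝ) :
    Tendsto (fun n => truncation (κ n) w) atTop (𝓝 w) := by
  have h1 : Tendsto (fun n => 1 + κ n * w) atTop (𝓝 (1 + 0 * w)) :=
    (hκ.mul_const w).const_add 1
  have h2 : Tendsto (fun n => κ n + w / (1 + κ n * w)) atTop (𝓝 (0 + w / (1 + 0 * w))) :=
    hκ.add (tendsto_const_nhds.div h1 (by simp))
  simpa [truncation] using h2

/-- The gradient bound for finite exponents. -/
theorem IsSolution.eLpNorm_gradient_le (hΩ : IsOpen Ω) (hc : Convex ℝ Ω)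
    (hne : Ω.Nonempty) (hne' : Ωᶜ.Nonempty) (hvol : volume Ω < ⊤) (hC1 : HasC1Boundary Ω)
    (hu : IsSolution Ω T α ε f u₀ Du₀ u) (ha : IsElliptic (regCoeff α ε)) {p : ℝ≥0∞} (hp : 2 < p)
    (hpt : p ≠ ⊤) (hf : ContDiffOn ℝ 1 (fun z : ℝ × Euc N => f z.1 z.2) (Ioo 0 T ×ˢ Ω))
    (hDu₀ : MemLp Du₀ p (volume.restrict Ω)) {t : ℝ} (ht : t ∈ Ioo 0 T) :
    eLpNorm (fun x => gradient (u t) x) p (volume.restrict Ω) ≤ ENNReal.ofReal (Real.exp T) *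
      (eLpNorm (fun z : ℝ × Euc N => gradient (f z.1) z.2) p (volume.restrict (Ioo 0 T ×ˢ Ω)) +
        eLpNorm Du₀ p (volume.restrict Ω)) := by
  set b := eLpNorm (fun z : ℝ × Euc N => gradient (f z.1) z.2) p
    (volume.restrict (Ioo 0 T ×ˢ Ω)) with hb
  set a := eLpNorm Du₀ p (volume.restrict Ω) with ha'
  rcases eq_or_ne b ⊤ with hbt | hbt
  · rw [hbt, top_add, ENNReal.mul_top (by simpa using Real.exp_pos T)]
    exact le_top
  set m := p.toReal with hm'
  have hp0 : p ≠ 0 := (lt_trans two_pos hp).ne'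
  have hm : 2 < m := by
    have := (ENNReal.toReal_lt_toReal ENNReal.ofNat_ne_top hpt).2 hp
    simpa using this
  have hp1 : 1 ≤ p := one_le_two.trans hp.le
  have : IsFiniteMeasure (volume.restrict Ω) := isFiniteMeasure_restrict.2 hvol.ne
  have hDf : IntegrableOn (fun z : ℝ × Euc N => ‖gradient (f z.1) z.2‖ ^ m) (Ioo 0 T ×ˢ Ω) := by
    have hmem : MemLp (fun z : ℝ × Euc N => gradient (f z.1) z.2) p
        (volume.restrict (Ioo 0 T ×ˢ Ω)) :=
      ⟨(continuousOn_gradient_slice hΩ hf).aestronglyMeasurable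
        (isOpen_Ioo.prod hΩ).measurableSet, lt_top_iff_ne_top.2 hbt⟩
    exact hmem.integrable_norm_rpow hp0 hpt
  set V := fun x => gradient (u t) x with hV
  set κ : ℕ → ℝ := fun n => 1 / ((n : ℝ) + 1) with hκdef
  have hκ0 : ∀ n, 0 < κ n := fun n => by positivity
  have hκ : Tendsto κ atTop (𝓝 0) := tendsto_one_div_add_atTop_nhds_zero_nat
  set e := ENNReal.ofReal (Real.exp ((m - 1) * t)) with he
  have hB : ∫⁻ z in Ioo 0 T ×ˢ Ω, ‖gradient (f z.1) z.2‖ₑ ^ m = b ^ m :=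
    lintegral_enorm_rpow_eq hp0 hpt _
  have hn : ∀ n, ∫⁻ x in Ω, ENNReal.ofReal (truncation (κ n) (‖V x‖ ^ 2) ^ (m / 2)) ≤
      e * ((a + ENNReal.ofReal (√(κ n)) * (volume.restrict Ω) univ ^ (1 / m)) ^ m + b ^ m) := by
    intro n
    calc _ ≤ ∫⁻ x in Ω, ENNReal.ofReal (truncatedPower m (κ n) (‖V x‖ ^ 2)) :=
          lintegral_mono fun x => ENNReal.ofReal_le_ofReal
            (truncation_rpow_le_truncatedPower hm (hκ0 n) (sq_nonneg _))
      _ ≤ _ := hu.lintegral_truncatedPower_le hΩ hc hne hne' hvol hC1 ha hm (hκ0 n) hf hDf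
          (hDu₀.mono_exponent hp.le) ht
      _ ≤ _ := by
          rw [hB]
          gcongr
          exact lintegral_sq_add_rpow_le hp1 hpt hDu₀.1 (hκ0 n).le
  have hlimR : Tendsto (fun n => e * ((a + ENNReal.ofReal (√(κ n)) *
      (volume.restrict Ω) univ ^ (1 / m)) ^ m + b ^ m)) atTop (𝓝 (e * (a ^ m + b ^ m))) := by
    have h1 : Tendsto (fun n => ENNReal.ofReal (√(κ n))) atTop (𝓝 0) := by
      have hcont : Continuous fun r : ℝ => ENNReal.ofReal (√r) :=
        ENNReal.continuous_ofReal.comp Real.continuous_sqrt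
      simpa [Function.comp_def] using (hcont.tendsto 0).comp hκ
    have h2 := ENNReal.Tendsto.mul_const h1 (b := (volume.restrict Ω) univ ^ (1 / m))
      (Or.inr (ENNReal.rpow_ne_top_of_nonneg (by positivity) (measure_ne_top _ _)))
    rw [zero_mul] at h2
    have h3 := ((ENNReal.continuous_rpow_const (y := m)).tendsto _).comp (h2.const_add a)
    rw [add_zero] at h3
    exact ENNReal.Tendsto.const_mul (h3.add_const _) (Or.inr ENNReal.ofReal_ne_top)
  have hVm : AEStronglyMeasurable V (volume.restrict Ω) :=
    aestronglyMeasurable_gradient hu.smooth hΩ hc hne ht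
  have hfatou : ∫⁻ x in Ω, ‖V x‖ₑ ^ m ≤ e * (a ^ m + b ^ m) := by
    have hlimL : ∀ x, Tendsto (fun n => ENNReal.ofReal (truncation (κ n) (‖V x‖ ^ 2) ^ (m / 2)))
        atTop (𝓝 (‖V x‖ₑ ^ m)) := by
      intro x
      have h1 := (tendsto_truncation hκ (‖V x‖ ^ 2)).rpow_const (p := m / 2)
        (Or.inr (by linarith))
      have h2 := (ENNReal.continuous_ofReal.tendsto _).comp h1
      rw [← ofReal_norm_rpow (V x) (by linarith)]
      have h3 : (‖V x‖ ^ 2) ^ (m / 2) = ‖V x‖ ^ m := by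
        rw [← Real.rpow_two, ← Real.rpow_mul (norm_nonneg _)]
        congr 1
        ring
      rw [h3] at h2
      exact h2
    calc ∫⁻ x in Ω, ‖V x‖ₑ ^ m = ∫⁻ x in Ω, liminf (fun n =>
          ENNReal.ofReal (truncation (κ n) (‖V x‖ ^ 2) ^ (m / 2))) atTop :=
          lintegral_congr fun x => (hlimL x).liminf_eq.symm
      _ ≤ liminf (fun n => ∫⁻ x in Ω,
          ENNReal.ofReal (truncation (κ n) (‖V x‖ ^ 2) ^ (m / 2))) atTop := by
          refine lintegral_liminf_le' fun n => ?_
          have hmeas : Measurable fun r : ℝ => truncation (κ n) (r ^ 2) ^ (m / 2) := by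
            unfold truncation
            fun_prop
          exact (hmeas.comp_aemeasurable hVm.norm.aemeasurable).ennreal_ofReal
      _ ≤ liminf (fun n => e * ((a + ENNReal.ofReal (√(κ n)) *
          (volume.restrict Ω) univ ^ (1 / m)) ^ m + b ^ m)) atTop :=
          liminf_le_liminf (Filter.Eventually.of_forall hn)
      _ = e * (a ^ m + b ^ m) := hlimR.liminf_eq
  have hm0 : 0 < m := by linarith
  have heT : e ≤ ENNReal.ofReal (Real.exp T) ^ m := by
    rw [ENNReal.ofReal_rpow_of_pos (Real.exp_pos _), ← Real.exp_mul, he]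
    refine ENNReal.ofReal_le_ofReal (Real.exp_le_exp.2 ?_)
    nlinarith [ht.1, ht.2]
  rw [← ENNReal.rpow_le_rpow_iff hm0, ← lintegral_enorm_rpow_eq hp0 hpt,
    ENNReal.mul_rpow_of_nonneg _ _ hm0.le]
  refine hfatou.trans (mul_le_mul' heT ?_)
  rw [add_comm]
  exact ENNReal.add_rpow_le_rpow_add _ _ (by linarith)

/-- On a finite measure space, bounds for the `Lᵖ` norms that are uniform up to a factor `R^(1/p)`
pass to the supremum norm. -/
theorem eLpNorm_top_le_of_forall_nat {X E : Type*} [MeasurableSpace X] [NormedAddCommGroup E]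
    {μ : Measure X} {F : X → E} (hF : AEStronglyMeasurable F μ) {K R : ℝ≥0∞} (hR : R ≠ ⊤)
    (h : ∀ n : ℕ, 3 ≤ n → eLpNorm F n μ ≤ K * R ^ (1 / (n : ℝ))) : eLpNorm F ⊤ μ ≤ K := by
  rw [eLpNorm_exponent_top]
  refine le_of_forall_gt_imp_ge_of_dense fun c hc => ?_
  rcases eq_or_ne c ⊤ with rfl | hct
  · exact le_top
  have hc0 : c ≠ 0 := (zero_le.trans_lt hc).ne'
  have hq : K / c < 1 := (ENNReal.div_lt_iff (Or.inl hc0) (Or.inl hct)).2 (by rwa [one_mul])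
  have hmeas : ∀ n : ℕ, 3 ≤ n → μ {x | c ≤ ‖F x‖ₑ} ≤ (K / c) ^ n * R := by
    intro n hn
    have hn0 : (n : ℝ≥0∞) ≠ 0 := by
      simp only [ne_eq, Nat.cast_eq_zero]
      omega
    have h1 := mul_meas_ge_le_pow_eLpNorm' μ hn0 (ENNReal.natCast_ne_top n) hF c
    have h2 : c ^ n * μ {x | c ≤ ‖F x‖ₑ} ≤ K ^ n * R := by
      have h3 := h1.trans (ENNReal.rpow_le_rpow (h n hn) ENNReal.toReal_nonneg)
      have hn1 : (n : ℝ) ≠ 0 := by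
        have : n ≠ 0 := by omega
        exact_mod_cast this
      rw [ENNReal.toReal_natCast, ENNReal.mul_rpow_of_nonneg _ _ (Nat.cast_nonneg n),
        ← ENNReal.rpow_mul, one_div_mul_cancel hn1, ENNReal.rpow_one, ENNReal.rpow_natCast,
        ENNReal.rpow_natCast] at h3
      exact h3
    have h4 : (K / c) ^ n * R = K ^ n * R / c ^ n := by
      rw [div_eq_mul_inv, mul_pow, ← ENNReal.inv_pow, div_eq_mul_inv]
      ring
    rw [h4, ENNReal.le_div_iff_mul_le (Or.inl (pow_ne_zero _ hc0))
      (Or.inl (ENNReal.pow_ne_top hct)), mul_comm]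
    exact h2
  have hzero : μ {x | c ≤ ‖F x‖ₑ} = 0 := by
    have hlim := ENNReal.Tendsto.mul_const
      (ENNReal.tendsto_pow_atTop_nhds_zero_of_lt_one hq) (Or.inr hR)
    rw [zero_mul] at hlim
    refine le_antisymm (ge_of_tendsto hlim ?_) zero_le
    filter_upwards [eventually_ge_atTop 3] with n hn
    exact hmeas n hn
  refine essSup_le_of_ae_le c ?_
  have : ∀ᵐ x ∂μ, ¬ c ≤ ‖F x‖ₑ := by
    rw [ae_iff]
    simpa using hzero
  filter_upwards [this] with x hx
  exact (not_le.1 hx).le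

/-- The gradient bound for the exponent `∞`, as the limit of the bounds for finite exponents. -/
theorem IsSolution.eLpNorm_top_gradient_le (hΩ : IsOpen Ω) (hc : Convex ℝ Ω)
    (hne : Ω.Nonempty) (hne' : Ωᶜ.Nonempty) (hvol : volume Ω < ⊤) (hC1 : HasC1Boundary Ω)
    (hu : IsSolution Ω T α ε f u₀ Du₀ u) (ha : IsElliptic (regCoeff α ε))
    (hf : ContDiffOn ℝ 1 (fun z : ℝ × Euc N => f z.1 z.2) (Ioo 0 T ×ˢ Ω))
    (hDu₀ : MemLp Du₀ ⊤ (volume.restrict Ω)) {t : ℝ} (ht : t ∈ Ioo 0 T) :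
    eLpNorm (fun x => gradient (u t) x) ⊤ (volume.restrict Ω) ≤ ENNReal.ofReal (Real.exp T) *
      (eLpNorm (fun z : ℝ × Euc N => gradient (f z.1) z.2) ⊤ (volume.restrict (Ioo 0 T ×ˢ Ω)) +
        eLpNorm Du₀ ⊤ (volume.restrict Ω)) := by
  have : IsFiniteMeasure (volume.restrict Ω) := isFiniteMeasure_restrict.2 hvol.ne
  have hQ : volume (Ioo 0 T ×ˢ Ω) ≠ ⊤ := by
    rw [Measure.volume_eq_prod, Measure.prod_prod]
    exact ENNReal.mul_ne_top measure_Ioo_lt_top.ne hvol.ne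
  set R := volume (Ioo 0 T ×ˢ Ω) + volume Ω with hR
  refine eLpNorm_top_le_of_forall_nat (R := R)
    (aestronglyMeasurable_gradient hu.smooth hΩ hc hne ht) (ENNReal.add_ne_top.2 ⟨hQ, hvol.ne⟩)
    fun n hn => ?_
  have h2 : (2 : ℝ≥0∞) < n := by exact_mod_cast hn
  have hfm : AEStronglyMeasurable (fun z : ℝ × Euc N => gradient (f z.1) z.2)
      (volume.restrict (Ioo 0 T ×ˢ Ω)) :=
    (continuousOn_gradient_slice hΩ hf).aestronglyMeasurable (isOpen_Ioo.prod hΩ).measurableSet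
  have hexp : 1 / ((n : ℝ≥0∞)).toReal - 1 / (⊤ : ℝ≥0∞).toReal = 1 / (n : ℝ) := by simp
  refine (hu.eLpNorm_gradient_le hΩ hc hne hne' hvol hC1 ha h2 (ENNReal.natCast_ne_top n) hf
    (hDu₀.mono_exponent le_top) ht).trans ?_
  rw [mul_assoc, add_mul]
  have hn0 : 0 ≤ 1 / (n : ℝ) := by positivity
  gcongr
  · refine (eLpNorm_le_eLpNorm_mul_rpow_measure_univ le_top hfm).trans ?_
    rw [hexp, Measure.restrict_apply_univ]
    gcongr
    exact le_self_add
  · refine (eLpNorm_le_eLpNorm_mul_rpow_measure_univ le_top hDu₀.1).trans ?_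
    rw [hexp, Measure.restrict_apply_univ]
    gcongr
    exact le_add_self

end

end QuasilinearNeumann

theorem theorem1 :
    ∃ C : ℝ≥0∞ → ℝ → ℝ≥0,
      (∀ T : ℝ, 0 < T → 0 < C ⊤ T ∧ Tendsto (fun m => C m T) (𝓝[<] ⊤) (𝓝 (C ⊤ T))) ∧
      ∀ (N : ℕ) (_ : 1 ≤ N) (Ω : Set (QuasilinearNeumann.Euc N))
        (_ : IsOpen Ω) (_ : Ω.Nonempty) (_ : Convex ℝ Ω)
        (_ : QuasilinearNeumann.HasC1Boundary Ω) (_ : volume Ω < ⊤)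
        (T : ℝ) (_ : 0 < T) (p : ℝ) (_ : 1 < p)
        (α : ℝ → ℝ) (_ : QuasilinearNeumann.IsDiffusion p α)
        (ε : ℝ) (_ : 0 < ε) (m : ℝ≥0∞) (_ : 2 < m)
        (f : ℝ → QuasilinearNeumann.Euc N → ℝ)
        (_ : ContDiffOn ℝ 1 (fun z : ℝ × QuasilinearNeumann.Euc N => f z.1 z.2) (Ioo 0 T ×ˢ Ω))
        (_ : MemLp (fun z : ℝ × QuasilinearNeumann.Euc N => f z.1 z.2) m
          (volume.restrict (Ioo 0 T ×ˢ Ω)))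
        (u₀ : QuasilinearNeumann.Euc N → ℝ)
        (Du₀ : QuasilinearNeumann.Euc N → QuasilinearNeumann.Euc N)
        (_ : QuasilinearNeumann.MemW1 m Ω u₀ Du₀)
        (u : ℝ → QuasilinearNeumann.Euc N → ℝ)
        (_ : QuasilinearNeumann.IsSolution Ω T α ε f u₀ Du₀ u),
        ⨆ t ∈ Ioo 0 T, eLpNorm (fun x => gradient (u t) x) m (volume.restrict Ω) ≤
          C m T *
            (eLpNorm (fun z : ℝ × QuasilinearNeumann.Euc N => gradient (f z.1) z.2) m
                (volume.restrict (Ioo 0 T ×ˢ Ω)) +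
              eLpNorm Du₀ m (volume.restrict Ω)) := by
  -- the constant in Gronwall's inequality, after taking `m`-th roots, does not depend on `m`
  refine ⟨fun _ T => (Real.exp T).toNNReal,
    fun T _ => ⟨Real.toNNReal_pos.2 (Real.exp_pos T), tendsto_const_nhds⟩, ?_⟩
  intro N hN Ω hΩ hne hc hC1 hvol T _ p _ α hα ε hε m hm f hf _ u₀ Du₀ hu₀ u hu
  refine iSup₂_le fun t ht => ?_
  have hne' := QuasilinearNeumann.compl_nonempty_of_volume_lt_top hN hvol
  have ha := hα.isElliptic hε
  rcases eq_or_ne m ⊤ with rfl | hmt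
  · exact hu.eLpNorm_top_gradient_le hΩ hc hne hne' hvol hC1 ha hf hu₀.2.1 ht
  · exact hu.eLpNorm_gradient_le hΩ hc hne hne' hvol hC1 ha hm hmt hf hu₀.2.1 ht
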